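/- **Setting.** For $g\in SL_d(\mathbb Z)$ let $\|g\|$ be its Euclidean operator norm. For an invertible complex matrix or operator $g$, let $\Lambda(g)$ be the maximum modulus of its eigenvalues and $\lambda(g)$ the second largest modulus of its eigenvalues, counted with algebraic multiplicity. For a set $\Sigma$ containing the identity, $\Sigma^N$ denotes the set of products of at most $N$ elements of $\Sigma$. Equip $\Lambda^i\mathbb C^d$ with its standard Hermitian norm, and $\mathbb P(\Lambda^i\mathbb C^d)$ with the distance $d([x],[y])=\|x\wedge y\|/(\|x\|\,\|y\|)$. An invertible linear map $g$ is called $\varepsilon$-contracting, with repelling hyperplane $H$ and attracting point $v$, if $d(gp,v)\le\varepsilon$ for every projective point $p$ with $d(p,H)\ge\varepsilon$. It is called $\varepsilon$-very contracting if both $g$ and $g^{-1}$ are $\varepsilon$-contracting. **Proposition.** For every $d$ there is $N=N(d)\in\mathbb N$ such that for every $r\in\mathbb R$ and every $q\in\mathbb N$ there is an integer $m_0=m_0(d,r,q)>0$ with the following property. Let $\Sigma\subset SL_d(\mathbb Z)$ be a set containing the identity and generating a subgroup that is Zariski dense in $SL_d(\mathbb R)$, and let $\alpha\in\Sigma$ be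 such that $$\Lambda(\alpha)=\max_{s\in\Sigma}\Lambda(s)\qquad\text{and}\qquad \|s\|\le\Lambda(\alpha)^{r}\ \text{ for all } s\in\Sigma .$$ Let $1\le i\le d-1$ be such that $A:=\Lambda^i\alpha$, acting on $\Lambda^i\mathbb C^d$, satisfies $\Lambda(A)/\lambda(A)\ge\Lambda(\alpha)^{1/d}$. Then $A$ has exactly one eigendirection $v\in\mathbb P(\Lambda^i\mathbb C^d)$ whose eigenvalue has modulus $\Lambda(A)$, and there is $B\in(\Lambda^i\Sigma)^N$, where $\Lambda^i\Sigma=\{\Lambda^i s: s\in\Sigma\}$, such that $A^{m_0}BA^{-m_0}$ is $\Lambda(A)^{-q}$-very contracting on $\mathbb P(\Lambda^i\mathbb C^d)$, with attracting points $v_1$ (of $A^{m_0}BA^{-m_0}$) and $v_2$ (of its inverse) satisfying $$d(v_1,v)\le\Lambda(A)^{-q},\qquad d(v_2,v)\le\Lambda(A)^{-q}.$$ -/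

import Mathlib

open scoped LinearAlgebra.Projectivization Pointwise MatrixGroups

namespace VeryContracting

noncomputable section

/-! ### Projective metric and contracting transformations -/

section Projective

variable {E : Type*} [NormedAddCommGroup E] [InnerProductSpace ℂ E]

/-- The norm `‖x ∧ y‖` of a bivector in the exterior square of `E`: the square root of the Gram
determinant `‖x‖² ‖y‖² - |⟨x, y⟩|²`. -/
def wedgeNorm (x y : E) : ℝ :=
  Real.sqrt (‖x‖ ^ 2 * ‖y‖ ^ 2 - ‖inner ℂ x y‖ ^ 2)

/-- The distance `‖x ∧ y‖ / (‖x‖ ‖y‖)` between the points `[x]` and `[y]` of projective space. -/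
def projDist (p q : ℙ ℂ E) : ℝ :=
  wedgeNorm p.rep q.rep / (‖p.rep‖ * ‖q.rep‖)

theorem wedgeNorm_smul_smul (a b : ℂ) (x y : E) :
    wedgeNorm (a • x) (b • y) = ‖a‖ * ‖b‖ * wedgeNorm x y := by
  unfold wedgeNorm
  have h : ‖a • x‖ ^ 2 * ‖b • y‖ ^ 2 - ‖inner ℂ (a • x) (b • y)‖ ^ 2
      = (‖a‖ * ‖b‖) ^ 2 * (‖x‖ ^ 2 * ‖y‖ ^ 2 - ‖inner ℂ x y‖ ^ 2) := by
    rw [inner_smul_left, inner_smul_right, norm_smul, norm_smul, norm_mul, norm_mul,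
      RCLike.norm_conj]
    ring
  rw [h, Real.sqrt_mul (sq_nonneg _), Real.sqrt_sq (by positivity)]

/-- The distance does not depend on the chosen representatives. -/
theorem projDist_mk (x y : E) (hx : x ≠ 0) (hy : y ≠ 0) :
    projDist (Projectivization.mk ℂ x hx) (Projectivization.mk ℂ y hy)
      = wedgeNorm x y / (‖x‖ * ‖y‖) := by
  obtain ⟨a, ha⟩ := Projectivization.exists_smul_eq_mk_rep ℂ x hx
  obtain ⟨b, hb⟩ := Projectivization.exists_smul_eq_mk_rep ℂ y hy
  have ha0 : ‖(a : ℂ)‖ ≠ 0 := norm_ne_zero_iff.2 a.ne_zero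
  have hb0 : ‖(b : ℂ)‖ ≠ 0 := norm_ne_zero_iff.2 b.ne_zero
  have hx0 : ‖x‖ ≠ 0 := norm_ne_zero_iff.2 hx
  have hy0 : ‖y‖ ≠ 0 := norm_ne_zero_iff.2 hy
  unfold projDist
  rw [← ha, ← hb, Units.smul_def, Units.smul_def, wedgeNorm_smul_smul, norm_smul, norm_smul]
  field_simp

/-- The distance `d(p, H) = inf_{q ∈ H} d(p, q)` from a point to a projective subspace, the latter
being given by the linear subspace `H` of `E`. -/
def distToSubspace (p : ℙ ℂ E) (H : Submodule ℂ E) : ℝ :=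
  ⨅ q : {q : ℙ ℂ E // q.submodule ≤ H}, projDist p q

/-- `g` is `ε`-contracting, with repelling hyperplane `H` and attracting point `v`. -/
def IsContractingWith (ε : ℝ) (g : LinearMap.GeneralLinearGroup ℂ E)
    (H : Submodule ℂ E) (v : ℙ ℂ E) : Prop :=
  IsCoatom H ∧ ∀ p : ℙ ℂ E, ε ≤ distToSubspace p H → projDist (g • p) v ≤ ε

/-- `g` is `ε`-very contracting, with attracting point `v₁` for `g` and attracting point `v₂` for
`g⁻¹`: both `g` and `g⁻¹` are `ε`-contracting. -/
def IsVeryContractingWith (ε : ℝ) (g : LinearMap.GeneralLinearGroup ℂ E)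
    (v₁ v₂ : ℙ ℂ E) : Prop :=
  (∃ H₁ : Submodule ℂ E, IsContractingWith ε g H₁ v₁) ∧
  (∃ H₂ : Submodule ℂ E, IsContractingWith ε g⁻¹ H₂ v₂)

end Projective

/-! ### Moduli of eigenvalues -/

section Eigenvalues

variable {V : Type*} [AddCommGroup V] [Module ℂ V] [FiniteDimensional ℂ V]

/-- The moduli of the eigenvalues of `T`, counted with algebraic multiplicity, in decreasing
order. -/
def eigenvalueModuli (T : V →ₗ[ℂ] V) : List ℝ :=
  (T.charpoly.roots.map (fun z : ℂ => ‖z‖)).sort (· ≥ ·)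

/-- `Λ(T)`: the maximum modulus of the eigenvalues of `T`. -/
def topModulus (T : V →ₗ[ℂ] V) : ℝ := (eigenvalueModuli T).getD 0 0

/-- `λ(T)`: the modulus of the second highest eigenvalue of `T`, counted with multiplicity. -/
def secondModulus (T : V →ₗ[ℂ] V) : ℝ := (eigenvalueModuli T).getD 1 0

/-- `v` is the direction of an eigenvector whose eigenvalue has the maximal modulus `Λ(T)`. -/
def IsTopEigendirection (T : V →ₗ[ℂ] V) (v : ℙ ℂ V) : Prop :=
  ∃ μ : ℂ, ‖μ‖ = topModulus T ∧ T v.rep = μ • v.rep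

end Eigenvalues

/-! ### Integer matrices of determinant one and their exterior powers -/

/-- The endomorphism of `ℂ^d` given by an integer matrix. -/
def toEnd (d : ℕ) : SL(d, ℤ) →* ((Fin d → ℂ) →ₗ[ℂ] (Fin d → ℂ)) where
  toFun g := Matrix.toLin' (g.1.map (Int.cast : ℤ → ℂ))
  map_one' := by
    simp [Module.End.one_eq_id]
  map_mul' g h := by
    have : ((g * h).1.map (Int.cast : ℤ → ℂ)) = g.1.map Int.cast * h.1.map Int.cast := by
      rw [Matrix.SpecialLinearGroup.coe_mul]
      exact Matrix.map_mul_intCast _ _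
    rw [this, Matrix.toLin'_mul]
    rfl

/-- The Euclidean operator norm of an integer matrix. -/
def opNorm {d : ℕ} (g : SL(d, ℤ)) : ℝ :=
  ‖Matrix.toEuclideanCLM (n := Fin d) (𝕜 := ℝ) (g.1.map (Int.cast : ℤ → ℝ))‖

/-- `Λ(g)`: the maximum modulus of the complex eigenvalues of an integer matrix. -/
def spectralModulus {d : ℕ} (g : SL(d, ℤ)) : ℝ := topModulus (toEnd d g)

/-- `Γ ≤ SL_d(ℤ)` is Zariski dense in `SL_d(ℝ)`: every real polynomial in the matrix entries that
vanishes on `Γ` vanishes on `SL_d(ℝ)`. -/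
def IsZariskiDense {d : ℕ} (Γ : Subgroup SL(d, ℤ)) : Prop :=
  ∀ P : MvPolynomial (Fin d × Fin d) ℝ,
    (∀ γ ∈ Γ, MvPolynomial.eval (fun ij => ((γ.1 ij.1 ij.2 : ℤ) : ℝ)) P = 0) →
    ∀ g : SL(d, ℝ), MvPolynomial.eval (fun ij => g.1 ij.1 ij.2) P = 0

/-- The exterior power `Λ^i ℂ^d` with its standard Hermitian norm, in coordinates with respect to
the orthonormal basis `e_{j_1} ∧ ⋯ ∧ e_{j_i}`, `j_1 < ⋯ < j_i`. -/
abbrev WedgeSpace (d i : ℕ) : Type := EuclideanSpace ℂ (Set.powersetCard (Fin d) i)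

/-- Coordinates on `Λ^i ℂ^d` with respect to the standard basis. -/
def wedgeEquiv (d i : ℕ) : (⋀[ℂ]^i (Fin d → ℂ)) ≃ₗ[ℂ] WedgeSpace d i :=
  ((Pi.basisFun ℂ (Fin d)).exteriorPower i).equivFun.trans
    (WithLp.linearEquiv 2 ℂ (Set.powersetCard (Fin d) i → ℂ)).symm

/-- The `i`-th exterior power of the standard representation of `SL_d(ℤ)` on `ℂ^d`. -/
def wedgeRep (d i : ℕ) : SL(d, ℤ) →* LinearMap.GeneralLinearGroup ℂ (WedgeSpace d i) :=
  MonoidHom.toHomUnits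
    { toFun := fun g => (wedgeEquiv d i).conj (exteriorPower.map i (toEnd d g))
      map_one' := by
        rw [map_one, Module.End.one_eq_id, exteriorPower.map_id, LinearEquiv.conj_id]
        rfl
      map_mul' := fun g h => by
        rw [map_mul, Module.End.mul_eq_comp, exteriorPower.map_comp, LinearEquiv.conj_comp]
        rfl }

end

end VeryContracting

open VeryContracting

/-! Let `v` be the top eigenvector of `A`, `φ` the functional reading the component along `v`, and
`g = A^m B A^{-m}`. Put `y = B A^{-m} x`. Then `A^m` multiplies the component `φ y` by a scalar of
modulus `Λ(A)^m`, but the remainder of `y` by at most about `(Λ(A)/t)^m`, where `t = Λ(α)^(1/d)`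
(`exists_proximal_data`). So `g` pushes `x` towards `v` unless `x` is close to the kernel of `ψ = φ
∘ B ∘ A^{-m}`, the repelling hyperplane. If the norm of `A^{-m}` is attained at `w`, both the error
and the lower bound for `ψ` carry the factor `‖A^{-m} w‖`, which cancels. It remains that `B` should
move the direction `u` of `A^{-m} w` quantitatively off `ker φ` (`isContractingWith_conj_pow`).
Since `g⁻¹` is the conjugate of `B⁻¹` by the same `A^m`, the same `v`, `φ`, `u` serve for it, and
both attracting points can be `v` itself.

To find `B` (`exists_mem_pow_one_le`), note that `φ(γu) φ(γ⁻¹u)` is linear in the products of an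
`i`-minor of `γ` and one of `γ⁻¹`. In this finite-dimensional space words of bounded length span
what the whole group spans, and Zariski density puts the vectors of all of `SL_d(ℝ)` in that span.
By compactness finitely many real matrices keep the form away from zero, uniformly in unit `φ` and
`u`. The vectors of words are integral, so a Gram determinant is at least 1, Cramer's rule bounds
coefficients polynomially, and some word keeps the form polynomially far from zero.

Every loss is a power of `t` times a power of `m + 1`. Since `Λ(α)` is bounded away from 1
(`exists_lt_forall_le_spectralModulus`), `t^m` absorbs all losses from an `m` on that does not
depend on `Σ`. -/

namespace VeryContracting

open Polynomial

/-! ### Quantitative spectral decomposition for a dominant simple eigenvalue -/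

section Spectral

variable {E : Type*} [NormedAddCommGroup E] [InnerProductSpace ℂ E]

/-- Growth of the powers of `T` on a vector annihilated by a product of factors `T - z` with
`‖z‖ ≤ l`. -/
theorem norm_pow_apply_le (T : Module.End ℂ E) {l K : ℝ} (hl : 0 < l) (hK0 : 0 ≤ K)
    (hK : ∀ z : ℂ, ‖z‖ ≤ l → ∀ x, ‖T x - z • x‖ ≤ K * ‖x‖) (s : Multiset ℂ) :
    (∀ z ∈ s, ‖z‖ ≤ l) → ∀ y : E, aeval T (s.map fun z => X - C z).prod y = 0 → ∀ m : ℕ,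
      ‖(T ^ m) y‖ ≤ l ^ m * (((m : ℝ) + 1) ^ s.card * (1 + K / l) ^ s.card) * ‖y‖ := by
  induction s using Multiset.induction with
  | empty =>
    intro _ y hy m
    have : y = 0 := by simpa using hy
    simp [this]
  | cons z s ih =>
    intro hs y hy m
    have hz : ‖z‖ ≤ l := hs z (Multiset.mem_cons_self _ _)
    have hs' : ∀ z ∈ s, ‖z‖ ≤ l := fun w hw => hs w (Multiset.mem_cons_of_mem hw)
    set y' : E := T y - z • y with hy'
    have hy0 : aeval T (s.map fun z => X - C z).prod y' = 0 := by
      rw [Multiset.map_cons, Multiset.prod_cons, mul_comm, map_mul, Module.End.mul_apply] at hy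
      rw [← hy, hy']
      congr 1
      simp [Module.algebraMap_end_apply]
    have hy'n : ‖y'‖ ≤ K * ‖y‖ := hK z hz y
    set c := s.card
    set R := 1 + K / l with hR
    have hKl : 0 ≤ K / l := by positivity
    have hR1 : 1 ≤ R := by linarith
    set D : ℝ := ((m : ℝ) + 1) ^ c * R ^ c * (K / l) * ‖y‖ with hD
    -- Unrolling `T^(j+1) y = z T^j y + T^j y'` adds one term per step. `D` is built with `m` in
    -- place of `j`, so it bounds all these terms at once.
    have key : ∀ j ≤ m, ‖(T ^ j) y‖ ≤ l ^ j * (‖y‖ + j * D) := by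
      intro j
      induction j with
      | zero => intro _; simp
      | succ j ihj =>
        intro hj
        have h1 : (T ^ (j + 1)) y = z • (T ^ j) y + (T ^ j) y' := by
          rw [pow_succ, Module.End.mul_apply, ← map_smul, ← map_add]
          congr 1
          rw [hy']; abel
        have h2 : ‖(T ^ j) y'‖ ≤ l ^ (j + 1) * D := by
          refine (ih hs' y' hy0 j).trans ?_
          have hjm : (j : ℝ) + 1 ≤ m + 1 := by
            have : (j : ℝ) ≤ m := by exact_mod_cast (Nat.le_of_succ_le hj)
            linarith
          calc l ^ j * (((j : ℝ) + 1) ^ c * R ^ c) * ‖y'‖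
              ≤ l ^ j * (((m : ℝ) + 1) ^ c * R ^ c) * (K * ‖y‖) := by gcongr
            _ = l ^ (j + 1) * D := by
              rw [hD, pow_succ]; field_simp
        calc ‖(T ^ (j + 1)) y‖ ≤ ‖z‖ * ‖(T ^ j) y‖ + ‖(T ^ j) y'‖ := by
              rw [h1]; exact (norm_add_le _ _).trans (by rw [norm_smul])
          _ ≤ l * (l ^ j * (‖y‖ + j * D)) + l ^ (j + 1) * D := by
              gcongr
              exact ihj (Nat.le_of_succ_le hj)
          _ = l ^ (j + 1) * (‖y‖ + (j + 1 : ℕ) * D) := by push_cast; ring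
    have h1 := key m le_rfl
    refine h1.trans ?_
    rw [mul_assoc]
    gcongr
    rw [Multiset.card_cons]
    have hm : (0 : ℝ) ≤ m := Nat.cast_nonneg m
    have hP : 1 ≤ ((m : ℝ) + 1) ^ c * R ^ c :=
      one_le_mul_of_one_le_of_one_le (one_le_pow₀ (by linarith)) (one_le_pow₀ hR1)
    calc ‖y‖ + m * D = (1 + m * (((m : ℝ) + 1) ^ c * R ^ c * (K / l))) * ‖y‖ := by rw [hD]; ring
      _ ≤ (((m : ℝ) + 1) ^ (c + 1) * R ^ (c + 1)) * ‖y‖ := by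
        gcongr
        rw [pow_succ, pow_succ]
        set Q := ((m : ℝ) + 1) ^ c * R ^ c with hQ
        have : ((m : ℝ) + 1) ^ c * (m + 1) * (R ^ c * R) = Q * ((m + 1) * (1 + K / l)) := by
          rw [hQ, ← hR]; ring
        rw [this]
        nlinarith [mul_nonneg (by linarith : 0 ≤ Q) hKl, mul_nonneg (by linarith : 0 ≤ Q) hm]

theorem norm_aeval_prod_le (T : Module.End ℂ E) {l K : ℝ} (hK0 : 0 ≤ K)
    (hK : ∀ z : ℂ, ‖z‖ ≤ l → ∀ x, ‖T x - z • x‖ ≤ K * ‖x‖) (s : Multiset ℂ) :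
    (∀ z ∈ s, ‖z‖ ≤ l) → ∀ y : E,
      ‖aeval T (s.map fun z => X - C z).prod y‖ ≤ K ^ s.card * ‖y‖ := by
  induction s using Multiset.induction with
  | empty => intro _ y; simp
  | cons z s ih =>
    intro hs y
    rw [Multiset.map_cons, Multiset.prod_cons, map_mul, Module.End.mul_apply, Multiset.card_cons,
      pow_succ', mul_assoc]
    have h := hK z (hs z (Multiset.mem_cons_self _ _)) (aeval T (s.map fun z => X - C z).prod y)
    have h2 : aeval T (X - C z : ℂ[X]) (aeval T (s.map fun z => X - C z).prod y)
        = T (aeval T (s.map fun z => X - C z).prod y)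
          - z • (aeval T (s.map fun z => X - C z).prod y) := by
      simp [Module.algebraMap_end_apply]
    rw [h2]
    exact h.trans (by gcongr; exact ih (fun w hw => hs w (Multiset.mem_cons_of_mem hw)) y)

/-- Each factor satisfies `‖μ - z‖ ≥ ‖μ‖ - l`. Divided into the bound of `norm_aeval_prod_le`, this
controls the functional `φ` below. -/
theorem pow_le_norm_eval_prod {l : ℝ} {μ : ℂ} (hl : l ≤ ‖μ‖) (s : Multiset ℂ)
    (hs : ∀ z ∈ s, ‖z‖ ≤ l) :
    (‖μ‖ - l) ^ s.card ≤ ‖(s.map fun z => X - C z).prod.eval μ‖ := by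
  induction s using Multiset.induction with
  | empty => simp
  | cons z s ih =>
    rw [Multiset.map_cons, Multiset.prod_cons, eval_mul, norm_mul, Multiset.card_cons, pow_succ']
    have h1 : ‖μ‖ - l ≤ ‖(X - C z : ℂ[X]).eval μ‖ := by
      have := norm_sub_norm_le μ z
      have := hs z (Multiset.mem_cons_self _ _)
      simp only [eval_sub, eval_X, eval_C]; linarith
    have h2 := ih fun w hw => hs w (Multiset.mem_cons_of_mem hw)
    have h3 : 0 ≤ ‖μ‖ - l := by linarith
    gcongr

/-- The spectral decomposition of an endomorphism with a simple eigenvalue of largest modulus: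
`φ x • v` is the component of `x` along the eigenline. -/
theorem exists_eigenvector_functional [FiniteDimensional ℂ E] (T : Module.End ℂ E) {μ : ℂ}
    {s : Multiset ℂ} (hT : T.charpoly.roots = μ ::ₘ s) {l K : ℝ} (hs : ∀ z ∈ s, ‖z‖ ≤ l)
    (hl : l < ‖μ‖) (hK0 : 0 ≤ K)
    (hK : ∀ z : ℂ, ‖z‖ ≤ l → ∀ x, ‖T x - z • x‖ ≤ K * ‖x‖) :
    ∃ (v : E) (φ : E →ₗ[ℂ] ℂ), ‖v‖ = 1 ∧ φ v = 1 ∧ T v = μ • v ∧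
      (∀ x, aeval T (s.map fun z => X - C z).prod (x - φ x • v) = 0) ∧
      (∀ x, ‖φ x‖ ≤ (K / (‖μ‖ - l)) ^ s.card * ‖x‖) ∧
      ∀ (w : E) (z : ℂ), w ≠ 0 → ‖z‖ = ‖μ‖ → T w = z • w → z = μ ∧ ∃ c : ℂ, w = c • v := by
  classical
  set Q : ℂ[X] := (s.map fun z => X - C z).prod with hQ
  have hchar : T.charpoly = (X - C μ) * Q := by
    have h := IsAlgClosed.splits T.charpoly
    rw [h.eq_prod_roots_of_monic T.charpoly_monic, hT, Multiset.map_cons, Multiset.prod_cons]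
  have hroot : ∀ z w, w ≠ 0 → T w = z • w → z ∈ μ ::ₘ s := by
    intro z w hw h
    have : T.HasEigenvalue z := Module.End.hasEigenvalue_of_hasEigenvector
      ⟨Module.End.mem_eigenspace_iff.2 h, hw⟩
    rw [← hT, mem_roots T.charpoly_monic.ne_zero]
    exact (Module.End.hasEigenvalue_iff_isRoot_charpoly T z).1 this
  have hμs : μ ∉ s := fun h => absurd (hs μ h) (not_le.2 hl)
  have hmult : T.charpoly.rootMultiplicity μ = 1 := by
    rw [← count_roots, hT, Multiset.count_cons_self, Multiset.count_eq_zero_of_notMem hμs]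
  have hev : T.HasEigenvalue μ := by
    rw [Module.End.hasEigenvalue_iff_isRoot_charpoly,
      ← mem_roots T.charpoly_monic.ne_zero, hT]
    exact Multiset.mem_cons_self _ _
  obtain ⟨v₀, hv₀, hv₀0⟩ := hev.exists_hasEigenvector
  have hv₀' : T v₀ = μ • v₀ := Module.End.mem_eigenspace_iff.1 hv₀
  set v : E := ((‖v₀‖ : ℂ)⁻¹) • v₀ with hv
  have hn0 : (‖v₀‖ : ℂ) ≠ 0 := by simpa using hv₀0
  have hv1 : ‖v‖ = 1 := by
    rw [hv, norm_smul, norm_inv, Complex.norm_real, norm_norm, inv_mul_cancel₀]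
    simpa using hv₀0
  have hTv : T v = μ • v := by rw [hv, map_smul, hv₀', smul_comm]
  have hv0 : v ≠ 0 := by rw [← norm_ne_zero_iff, hv1]; exact one_ne_zero
  -- The root `μ` is simple and geometric multiplicity is at most algebraic multiplicity, so the
  -- eigenspace is a line.
  have hline : ∀ w, T w = μ • w → ∃ c : ℂ, w = c • v := by
    intro w hw
    have h1 := T.finrank_eigenspace_le μ
    rw [hmult] at h1
    obtain ⟨u, hu⟩ := finrank_le_one_iff.1 h1
    obtain ⟨a, ha⟩ := hu ⟨w, Module.End.mem_eigenspace_iff.2 hw⟩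
    obtain ⟨b, hb⟩ := hu ⟨v, Module.End.mem_eigenspace_iff.2 hTv⟩
    have ha' : a • (u : E) = w := congrArg Subtype.val ha
    have hb' : b • (u : E) = v := congrArg Subtype.val hb
    have hb0 : b ≠ 0 := by
      rintro rfl; rw [zero_smul] at hb'; exact hv0 hb'.symm
    exact ⟨a * b⁻¹, by rw [← hb', smul_smul, mul_assoc, inv_mul_cancel₀ hb0, mul_one, ha']⟩
  -- Cayley–Hamilton: `(T - μ) Q(T) = 0`, so `Q(T)` maps into the eigenline. Dividing by `Q(μ)`
  -- turns it into the projection onto that line, whose coordinate is `φ`.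
  have hQT : ∀ x, T (aeval T Q x) = μ • aeval T Q x := by
    intro x
    have h := LinearMap.aeval_self_charpoly T
    rw [hchar, map_mul] at h
    have h2 := LinearMap.congr_fun h x
    simp only [map_sub, aeval_X, aeval_C, Module.End.mul_apply, LinearMap.sub_apply,
      Module.algebraMap_end_apply, LinearMap.zero_apply] at h2
    exact sub_eq_zero.1 h2
  have hQv : aeval T Q v = Q.eval μ • v := by
    have : T.HasEigenvector μ v := ⟨Module.End.mem_eigenspace_iff.2 hTv, hv0⟩
    exact Module.End.aeval_apply_of_hasEigenvector this
  have hge := pow_le_norm_eval_prod hl.le s hs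
  have hpos : 0 < (‖μ‖ - l) ^ s.card := pow_pos (by linarith) _
  have hQμ : Q.eval μ ≠ 0 := by rw [← norm_pos_iff]; exact hpos.trans_le hge
  set φ : E →ₗ[ℂ] ℂ := (Q.eval μ)⁻¹ • ((innerₛₗ ℂ v) ∘ₗ aeval T Q) with hφ
  have hφv : ∀ x, aeval T Q x = (Q.eval μ * φ x) • v := by
    intro x
    obtain ⟨c, hc⟩ := hline _ (hQT x)
    have : φ x = (Q.eval μ)⁻¹ * c := by
      simp [hφ, hc, inner_self_eq_norm_sq_to_K, hv1, inner_smul_right]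
    rw [this, mul_inv_cancel_left₀ hQμ, hc]
  have hφ1 : φ v = 1 := by
    simp [hφ, hQv, inner_smul_right, inner_self_eq_norm_sq_to_K, hv1, hQμ]
  refine ⟨v, φ, hv1, hφ1, hTv, ?_, ?_, ?_⟩
  · intro x
    rw [map_sub, map_smul, hQv, hφv x, mul_comm, mul_smul, sub_self]
  · intro x
    have h1 := norm_aeval_prod_le T hK0 hK s hs x
    have h2 : ‖φ x‖ ≤ ‖Q.eval μ‖⁻¹ * ‖aeval T Q x‖ := by
      have h3 : ‖(inner ℂ v (aeval T Q x) : ℂ)‖ ≤ ‖aeval T Q x‖ := by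
        simpa [hv1] using norm_inner_le_norm (𝕜 := ℂ) v (aeval T Q x)
      simp only [hφ, LinearMap.smul_apply, LinearMap.comp_apply, innerₛₗ_apply_apply, smul_eq_mul,
        norm_mul, norm_inv]
      gcongr
    refine h2.trans ?_
    rw [div_pow, div_mul_eq_mul_div, inv_mul_eq_div]
    gcongr
  · intro w z hw hz h
    have hzμ : z = μ := by
      rcases Multiset.mem_cons.1 (hroot z w hw h) with h | h
      · exact h
      · have := hs z h; linarith
    exact ⟨hzμ, hline w (hzμ ▸ h)⟩

end Spectral

/-! ### Moduli of eigenvalues and the determinant -/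

section Moduli

variable {V : Type*} [AddCommGroup V] [Module ℂ V] [FiniteDimensional ℂ V]

theorem exists_eigenvalueModuli_eq_cons (T : Module.End ℂ V) {a : ℝ} {t : List ℝ}
    (h : eigenvalueModuli T = a :: t) : ∃ (μ : ℂ) (s : Multiset ℂ),
      T.charpoly.roots = μ ::ₘ s ∧ ‖μ‖ = a ∧ s.map (fun z => ‖z‖) = (t : Multiset ℝ) ∧
      (∀ z ∈ s, ‖z‖ ≤ a) := by
  classical
  have hm : T.charpoly.roots.map (fun z : ℂ => ‖z‖) = ((a :: t : List ℝ) : Multiset ℝ) := by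
    rw [← h]; exact (Multiset.sort_eq _ _).symm
  have ha : a ∈ T.charpoly.roots.map (fun z : ℂ => ‖z‖) := by rw [hm]; simp
  obtain ⟨μ, hμ, hμa⟩ := Multiset.mem_map.1 ha
  obtain ⟨s, hs⟩ := Multiset.exists_cons_of_mem hμ
  have ht : s.map (fun z => ‖z‖) = (t : Multiset ℝ) := by
    rw [hs, Multiset.map_cons, hμa, ← Multiset.cons_coe] at hm
    exact (Multiset.cons_inj_right _).1 hm
  refine ⟨μ, s, hs, hμa, ht, fun z hz => ?_⟩
  have hsort : (eigenvalueModuli T).Pairwise (· ≥ ·) := Multiset.pairwise_sort _ _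
  rw [h, List.pairwise_cons] at hsort
  exact hsort.1 ‖z‖ (by rw [← Multiset.mem_coe, ← ht]; exact Multiset.mem_map_of_mem _ hz)

/-- `secondModulus` takes the default value 0 on lists with fewer than two entries, so being nonzero
guarantees a second eigenvalue. -/
theorem exists_roots_eq_cons (T : Module.End ℂ V) (h : secondModulus T ≠ 0) :
    ∃ (μ : ℂ) (s : Multiset ℂ), T.charpoly.roots = μ ::ₘ s ∧ ‖μ‖ = topModulus T ∧
      (∀ z ∈ s, ‖z‖ ≤ secondModulus T) ∧ s ≠ 0 := by
  unfold secondModulus topModulus at *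
  have hsort : (eigenvalueModuli T).Pairwise (· ≥ ·) := Multiset.pairwise_sort _ _
  match hl : eigenvalueModuli T with
  | [] => simp [hl] at h
  | [a] => simp [hl] at h
  | a :: b :: t =>
    obtain ⟨μ, s, hs, hμ, ht, -⟩ := exists_eigenvalueModuli_eq_cons T hl
    refine ⟨μ, s, hs, by simpa using hμ, fun z hz => ?_, ?_⟩
    · have hz' : ‖z‖ ∈ b :: t := by
        rw [← Multiset.mem_coe, ← ht]; exact Multiset.mem_map_of_mem _ hz
      rw [hl, List.pairwise_cons, List.pairwise_cons] at hsort
      rcases List.mem_cons.1 hz' with h | h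
      · simp [h]
      · simpa using hsort.2.1 _ h
    · rintro rfl; simpa using congrArg Multiset.card ht

theorem norm_le_topModulus (T : Module.End ℂ V) {z : ℂ} (hz : z ∈ T.charpoly.roots) :
    ‖z‖ ≤ topModulus T := by
  unfold topModulus
  match hl : eigenvalueModuli T with
  | [] =>
    have : T.charpoly.roots.map (fun z : ℂ => ‖z‖) = (([] : List ℝ) : Multiset ℝ) := by
      rw [← hl]; exact (Multiset.sort_eq _ _).symm
    rw [Multiset.coe_nil, Multiset.map_eq_zero] at this
    simp [this] at hz
  | a :: t =>
    obtain ⟨μ, s, hs, hμ, ht, h⟩ := exists_eigenvalueModuli_eq_cons T hl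
    rw [hs] at hz
    rcases Multiset.mem_cons.1 hz with rfl | hz
    · simp [hμ]
    · simpa using h z hz

theorem norm_multiset_prod_le {s : Multiset ℂ} {l : ℝ} (hs : ∀ z ∈ s, ‖z‖ ≤ l) :
    ‖s.prod‖ ≤ l ^ s.card := by
  induction s using Multiset.induction with
  | empty => simp
  | cons z s ih =>
    have hz := hs z (Multiset.mem_cons_self _ _)
    rw [Multiset.prod_cons, norm_mul, Multiset.card_cons, pow_succ']
    exact mul_le_mul hz (ih fun w hw => hs w (Multiset.mem_cons_of_mem hw)) (norm_nonneg _)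
      ((norm_nonneg z).trans hz)

theorem norm_roots_prod (T : Module.End ℂ V) : ‖T.charpoly.roots.prod‖ = ‖LinearMap.det T‖ := by
  rw [LinearMap.det_eq_sign_charpoly_coeff,
    (IsAlgClosed.splits T.charpoly).coeff_zero_eq_prod_roots_of_monic T.charpoly_monic]
  simp

/-- The moduli of the eigenvalues multiply to `‖det T‖ = 1`, so they cannot all be smaller than 1.
-/
theorem one_le_topModulus [Nontrivial V] (T : Module.End ℂ V) (h : ‖LinearMap.det T‖ = 1) :
    1 ≤ topModulus T := by
  have h1 := norm_multiset_prod_le fun z hz => norm_le_topModulus T hz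
  rw [norm_roots_prod, h] at h1
  have hcard : T.charpoly.roots.card ≠ 0 := by
    rw [← (IsAlgClosed.splits T.charpoly).natDegree_eq_card_roots, LinearMap.charpoly_natDegree]
    exact Module.finrank_pos.ne'
  by_contra! hlt
  have h0 : 0 ≤ topModulus T := by
    obtain ⟨z, hz⟩ := Multiset.card_pos_iff_exists_mem.1 (Nat.pos_of_ne_zero hcard)
    exact (norm_nonneg z).trans (norm_le_topModulus T hz)
  exact absurd h1 (not_le.2 (pow_lt_one₀ h0 hlt hcard))

theorem exists_root_norm_eq_topModulus [Nontrivial V] (T : Module.End ℂ V) :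
    ∃ (z : ℂ) (w : V), w ≠ 0 ∧ T w = z • w ∧ ‖z‖ = topModulus T := by
  have hcard : T.charpoly.roots.card ≠ 0 := by
    rw [← (IsAlgClosed.splits T.charpoly).natDegree_eq_card_roots, LinearMap.charpoly_natDegree]
    exact Module.finrank_pos.ne'
  unfold topModulus
  match hl : eigenvalueModuli T with
  | [] =>
    have : T.charpoly.roots.map (fun z : ℂ => ‖z‖) = (([] : List ℝ) : Multiset ℝ) := by
      rw [← hl]; exact (Multiset.sort_eq _ _).symm
    rw [Multiset.coe_nil, Multiset.map_eq_zero] at this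
    simp [this] at hcard
  | a :: t =>
    obtain ⟨μ, s, hs, hμ, ht, h⟩ := exists_eigenvalueModuli_eq_cons T hl
    have hev : T.HasEigenvalue μ := by
      rw [Module.End.hasEigenvalue_iff_isRoot_charpoly,
        ← mem_roots T.charpoly_monic.ne_zero, hs]
      exact Multiset.mem_cons_self _ _
    obtain ⟨w, hw, hw0⟩ := hev.exists_hasEigenvector
    exact ⟨μ, w, hw0, Module.End.mem_eigenspace_iff.1 hw, by simpa using hμ⟩

/-- If `|det T| = 1`, the second modulus is at least the inverse of the first. -/
theorem one_le_topModulus_mul_secondModulus (T : Module.End ℂ V) (hdet : ‖LinearMap.det T‖ = 1)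
    (h : 0 < secondModulus T) (h1 : 1 ≤ topModulus T) :
    1 ≤ topModulus T * secondModulus T := by
  obtain ⟨μ, s, hs, hμ, hle, hs0⟩ := exists_roots_eq_cons T h.ne'
  rcases le_total 1 (secondModulus T) with h2 | h2
  · exact one_le_mul_of_one_le_of_one_le h1 h2
  -- When the second modulus is at most 1, the product of all eigenvalues but the top one is at most
  -- the second modulus itself, as there is at least one such eigenvalue.
  · have h3 := norm_roots_prod T
    rw [hdet, hs, Multiset.prod_cons, norm_mul, hμ] at h3
    have h4 := norm_multiset_prod_le hle
    have h5 : secondModulus T ^ s.card ≤ secondModulus T := by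
      have := pow_le_pow_of_le_one h.le h2 (Multiset.card_pos.2 hs0 : 1 ≤ s.card)
      simpa using this
    rw [← h3]
    gcongr
    exact h4.trans h5

end Moduli

/-! ### From norm estimates to projective contraction -/

section Contraction

variable {E : Type*} [NormedAddCommGroup E] [InnerProductSpace ℂ E]

theorem wedgeNorm_le (x y : E) : wedgeNorm x y ≤ ‖x‖ * ‖y‖ := by
  unfold wedgeNorm
  refine Real.sqrt_le_iff.2 ⟨by positivity, ?_⟩
  nlinarith [sq_nonneg ‖inner ℂ x y‖]

theorem wedgeNorm_nonneg (x y : E) : 0 ≤ wedgeNorm x y := Real.sqrt_nonneg _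

/-- This is `(x + c y) ∧ y = x ∧ y`, checked on Gram determinants. It lets distances be read off
from the component transverse to a line. -/
theorem wedgeNorm_add_smul (x y : E) (c : ℂ) : wedgeNorm (x + c • y) y = wedgeNorm x y := by
  unfold wedgeNorm
  congr 1
  have h1 : ‖x + c • y‖ ^ 2 = ‖x‖ ^ 2 + 2 * (c * inner ℂ x y).re + ‖c‖ ^ 2 * ‖y‖ ^ 2 := by
    rw [norm_add_sq (𝕜 := ℂ), inner_smul_right, norm_smul, mul_pow]
    rfl
  have h2 : (inner ℂ (x + c • y) y : ℂ) = inner ℂ x y + (starRingEnd ℂ) c * (‖y‖ : ℂ) ^ 2 := by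
    rw [inner_add_left, inner_smul_left, inner_self_eq_norm_sq_to_K]
    rfl
  rw [h1, h2, Complex.sq_norm, Complex.sq_norm, Complex.sq_norm]
  simp only [Complex.normSq_apply, Complex.add_re, Complex.add_im, Complex.mul_re, Complex.mul_im,
    Complex.conj_re, Complex.conj_im, ← Complex.ofReal_pow, Complex.ofReal_re, Complex.ofReal_im]
  ring

theorem wedgeNorm_self (x : E) : wedgeNorm x x = 0 := by
  have := wedgeNorm_add_smul (0 : E) x 1
  rw [zero_add, one_smul] at this
  rw [this]
  simp [wedgeNorm]

theorem projDist_self (p : ℙ ℂ E) : projDist p p = 0 := by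
  rw [projDist, wedgeNorm_self, zero_div]

theorem projDist_nonneg (p q : ℙ ℂ E) : 0 ≤ projDist p q :=
  div_nonneg (wedgeNorm_nonneg _ _) (by positivity)

theorem distToSubspace_le (p q : ℙ ℂ E) {H : Submodule ℂ E} (hq : q.submodule ≤ H) :
    distToSubspace p H ≤ projDist p q :=
  ciInf_le (f := fun q : {q : ℙ ℂ E // q.submodule ≤ H} => projDist p q)
    ⟨0, by rintro _ ⟨q, rfl⟩; exact projDist_nonneg _ _⟩ ⟨q, hq⟩

/-- A point far from the kernel of `ψ` has a large value of `ψ`. -/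
theorem mul_le_norm_of_le_distToSubspace (ψ : E →ₗ[ℂ] ℂ) {w x : E} (hw : ‖w‖ = 1) (hx : x ≠ 0)
    (hψ : ψ w ≠ 0) {ε : ℝ} (hε : ε ≤ 1)
    (h : ε ≤ distToSubspace (Projectivization.mk ℂ x hx) (LinearMap.ker ψ)) :
    ε * ‖ψ w‖ * ‖x‖ ≤ ‖ψ x‖ := by
  -- `x - c • w` is the projection of `x` to `ker ψ` along `w`, and its distance to `[x]` is at most
  -- `‖c‖ / ‖x‖`.
  set c := ψ x / ψ w with hc
  have hcn : ‖c‖ * ‖ψ w‖ = ‖ψ x‖ := by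
    rw [hc, norm_div, div_mul_cancel₀ _ (norm_ne_zero_iff.2 hψ)]
  have hx0 : 0 < ‖x‖ := norm_pos_iff.2 hx
  suffices hs : ε * ‖x‖ ≤ ‖c‖ by
    rw [← hcn]
    nlinarith [norm_nonneg (ψ w)]
  -- If `x` is a multiple of `w`, its projection is no projective point; then `‖c‖ = ‖x‖` and `ε ≤
  -- 1` is enough.
  by_cases hq : x - c • w = 0
  · have : ‖x‖ = ‖c‖ := by rw [sub_eq_zero.1 hq, norm_smul, hw, mul_one]
    nlinarith
  · have hker : (Projectivization.mk ℂ (x - c • w) hq).submodule ≤ LinearMap.ker ψ := by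
      rw [Projectivization.submodule_mk, Submodule.span_singleton_le_iff_mem, LinearMap.mem_ker,
        map_sub, map_smul, smul_eq_mul, hc, div_mul_cancel₀ _ hψ, sub_self]
    have h1 := h.trans (distToSubspace_le _ _ hker)
    rw [projDist_mk] at h1
    have h2 : wedgeNorm x (x - c • w) ≤ ‖c‖ * ‖x - c • w‖ := by
      have h3 : x = c • w + (1 : ℂ) • (x - c • w) := by rw [one_smul]; abel
      have h4 : wedgeNorm x (x - c • w) = wedgeNorm (c • w) (x - c • w) := by
        conv_lhs => rw [h3]
        have : c • w + (1 : ℂ) • (x - c • w) - c • w = x - c • w := by rw [one_smul]; abel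
        rw [this, wedgeNorm_add_smul]
      rw [h4]
      refine (wedgeNorm_le _ _).trans ?_
      rw [norm_smul, hw, mul_one]
    have h5 : 0 < ‖x - c • w‖ := norm_pos_iff.2 hq
    rw [le_div_iff₀ (by positivity)] at h1
    have h6 := h1.trans h2
    rw [← mul_assoc] at h6
    exact le_of_mul_le_mul_right h6 h5

/-- Conjugating by a large power of a proximal transformation `A` makes `B` contracting towards the
top eigendirection of `A`. -/
theorem isContractingWith_conj_pow (A B : LinearMap.GeneralLinearGroup ℂ E) (m : ℕ) {v w : E}
    {φ : E →ₗ[ℂ] ℂ} {μ : ℂ} {κ P η ε : ℝ} (hv : ‖v‖ = 1) (hv0 : v ≠ 0) (hAv : A.val v = μ • v)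
    (hκ : 0 ≤ κ) (hA : ∀ x, ‖(A.val ^ m) (x - φ x • v)‖ ≤ κ * ‖x‖)
    (hP : 0 ≤ P) (hB : ∀ x, ‖B.val x‖ ≤ P * ‖x‖) (hw : ‖w‖ = 1)
    (hwmax : ∀ p, ‖(A ^ m)⁻¹.val p‖ ≤ ‖(A ^ m)⁻¹.val w‖ * ‖p‖) (hη : 0 < η)
    (hφ : η * ‖(A ^ m)⁻¹.val w‖ ≤ ‖φ (B.val ((A ^ m)⁻¹.val w))‖)
    (hε0 : 0 < ε) (hε1 : ε ≤ 1) (hbig : 2 * κ * P ≤ ε ^ 2 * (‖μ‖ ^ m * η)) :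
    ∃ H, IsContractingWith ε (A ^ m * B * (A ^ m)⁻¹) H (Projectivization.mk ℂ v hv0) := by
  set U := (A ^ m)⁻¹ with hU
  set ψ : E →ₗ[ℂ] ℂ := φ ∘ₗ B.val ∘ₗ U.val with hψ
  have hw0 : w ≠ 0 := by rw [← norm_ne_zero_iff, hw]; exact one_ne_zero
  have hUw : U.val w ≠ 0 := by
    intro h
    apply hw0
    have : ((A ^ m) * U).val w = w := by rw [hU, mul_inv_cancel]; rfl
    rw [← this, Units.val_mul, Module.End.mul_apply, h, map_zero]
  have hUw0 : 0 < ‖U.val w‖ := norm_pos_iff.2 hUw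
  have hψw : η * ‖U.val w‖ ≤ ‖ψ w‖ := hφ
  have hψw0 : ψ w ≠ 0 := by rw [← norm_pos_iff]; exact (by positivity : 0 < η * ‖U.val w‖).trans_le hψw
  refine ⟨LinearMap.ker ψ, LinearMap.isCoatom_ker_of_surjective
    (LinearMap.surjective (fun h => hψw0 (by rw [h]; rfl))), fun p hp => ?_⟩
  induction p using Projectivization.ind with
  | h x hx =>
  have hmain := mul_le_norm_of_le_distToSubspace ψ hw hx hψw0 hε1 hp
  rw [Projectivization.smul_mk, projDist_mk, hv, mul_one]
  set y : E := B.val (U.val x) with hy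
  have hg : (A ^ m * B * U) • x = (A.val ^ m) y := by
    simp [Units.smul_def, hy, Module.End.smul_def]
  set e : E := (A.val ^ m) (y - φ y • v) with he
  have hAm : ∀ k : ℕ, (A.val ^ k) v = μ ^ k • v := by
    intro k
    induction k with
    | zero => simp
    | succ k ih => rw [pow_succ, Module.End.mul_apply, hAv, map_smul, ih, smul_smul, pow_succ']
  have hdec : (A.val ^ m) y = e + (μ ^ m * φ y) • v := by
    rw [he, map_sub, map_smul, hAm, smul_smul, mul_comm (φ y)]
    abel
  -- The maximality of `w` puts `‖U w‖` into this upper bound; the lower bound for `φ y` has the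
  -- same factor, so the size of `A^{-m}` never needs to be estimated.
  have hye : ‖e‖ ≤ κ * (P * (‖U.val w‖ * ‖x‖)) := by
    refine (hA y).trans ?_
    gcongr
    refine (hB _).trans ?_
    gcongr
    exact hwmax x
  have hφy : ε * (η * ‖U.val w‖) * ‖x‖ ≤ ‖φ y‖ := by
    refine le_trans ?_ hmain
    gcongr
  have hx0 : 0 < ‖x‖ := norm_pos_iff.2 hx
  -- One `ε` pays for the distance of `x` to the hyperplane, the other is the contraction ratio. The
  -- factor 2 pays for the loss of `‖e‖` in the lower bound `h2` for `‖A^m y‖`.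
  have hμφ : 2 * ‖e‖ ≤ ε * (‖μ‖ ^ m * ‖φ y‖) := by
    calc 2 * ‖e‖ ≤ 2 * (κ * (P * (‖U.val w‖ * ‖x‖))) := by gcongr
      _ = (2 * κ * P) * (‖U.val w‖ * ‖x‖) := by ring
      _ ≤ (ε ^ 2 * (‖μ‖ ^ m * η)) * (‖U.val w‖ * ‖x‖) := by gcongr
      _ = ε * (‖μ‖ ^ m * (ε * (η * ‖U.val w‖) * ‖x‖)) := by ring
      _ ≤ ε * (‖μ‖ ^ m * ‖φ y‖) := by gcongr
  have hgx0 : (A ^ m * B * U) • x ≠ 0 := (smul_ne_zero_iff_ne _).2 hx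
  rw [hg] at hgx0
  rw [hg, div_le_iff₀ (norm_pos_iff.2 hgx0)]
  have h1 : wedgeNorm ((A.val ^ m) y) v ≤ ‖e‖ := by
    rw [hdec, wedgeNorm_add_smul]
    simpa [hv] using wedgeNorm_le e v
  have h2 : ‖μ‖ ^ m * ‖φ y‖ - ‖e‖ ≤ ‖(A.val ^ m) y‖ := by
    rw [hdec]
    have h3 : ‖(μ ^ m * φ y) • v‖ = ‖μ‖ ^ m * ‖φ y‖ := by rw [norm_smul, hv, norm_mul, norm_pow, mul_one]
    have h4 := norm_sub_le (e + (μ ^ m * φ y) • v) e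
    rw [add_sub_cancel_left, h3] at h4
    linarith
  refine h1.trans (le_trans ?_ (mul_le_mul_of_nonneg_left h2 hε0.le))
  nlinarith [norm_nonneg e]

end Contraction

end VeryContracting

namespace VeryContracting

/-! ### Exterior powers as matrices of minors -/

section Compound

open Set.powersetCard

variable {d : ℕ} {R R' : Type*} [CommRing R] [CommRing R']

/-- The `i`-th compound matrix: the matrix of all minors of size `i`. -/
def compound (i : ℕ) (M : Matrix (Fin d) (Fin d) R) :
    Matrix (Set.powersetCard (Fin d) i) (Set.powersetCard (Fin d) i) R :=
  Matrix.of fun I J => (M.submatrix (ofFinEmbEquiv.symm I) (ofFinEmbEquiv.symm J)).det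

theorem compound_apply (i : ℕ) (M : Matrix (Fin d) (Fin d) R) (I J) :
    compound i M I J = (M.submatrix (ofFinEmbEquiv.symm I) (ofFinEmbEquiv.symm J)).det := rfl

theorem compound_map (i : ℕ) (f : R →+* R') (M : Matrix (Fin d) (Fin d) R) :
    compound i (M.map f) = (compound i M).map f := by
  ext I J
  rw [compound_apply, Matrix.map_apply, compound_apply, RingHom.map_det]
  rfl

theorem compound_smul (i : ℕ) (c : R) (M : Matrix (Fin d) (Fin d) R) :
    compound i (c • M) = c ^ i • compound i M := by
  ext I J
  rw [compound_apply, Matrix.smul_apply, compound_apply, Matrix.submatrix_smul, Pi.smul_apply,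
    Pi.smul_apply, Matrix.det_smul, Fintype.card_fin, smul_eq_mul]

theorem wedgeEquiv_conj_map_apply (i : ℕ) (M : Matrix (Fin d) (Fin d) ℂ) (x : WedgeSpace d i)
    (I : Set.powersetCard (Fin d) i) :
    (wedgeEquiv d i).conj (exteriorPower.map i (Matrix.toLin' M)) x I
      = ∑ J, compound i M I J * x J := by
  set b := (Pi.basisFun ℂ (Fin d)).exteriorPower i with hb
  have h1 : (wedgeEquiv d i).symm x = ∑ J, x J • b J := by
    simp [wedgeEquiv, Module.Basis.equivFun_symm_apply, hb]
  have h2 : ∀ y, wedgeEquiv d i y I = b.repr y I := by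
    intro y; simp [wedgeEquiv, hb]
  rw [LinearEquiv.conj_apply_apply, h1, h2, map_sum, map_sum, Finsupp.finsetSum_apply]
  refine Finset.sum_congr rfl fun J _ => ?_
  rw [map_smul, map_smul, Finsupp.smul_apply, smul_eq_mul, mul_comm]
  congr 1
  rw [hb, exteriorPower.basis_apply, exteriorPower.map_apply_ιMulti_family,
    exteriorPower.basis_repr_apply, exteriorPower.ιMulti_family,
    exteriorPower.ιMultiDual_apply_ιMulti, compound_apply, ← Matrix.det_transpose]
  congr 1
  ext k l
  simp

theorem wedgeRep_apply (i : ℕ) (g : SL(d, ℤ)) (x : WedgeSpace d i)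
    (I : Set.powersetCard (Fin d) i) :
    (wedgeRep d i g).val x I = ∑ J, compound i (g.1.map (Int.cast : ℤ → ℂ)) I J * x J :=
  wedgeEquiv_conj_map_apply i _ x I

/-- The Cauchy–Binet formula, obtained from functoriality of the exterior power evaluated on basis
vectors. -/
theorem compound_mul_complex (i : ℕ) (M M' : Matrix (Fin d) (Fin d) ℂ) :
    compound i (M * M') = compound i M * compound i M' := by
  ext I J
  have h1 : (wedgeEquiv d i).conj (exteriorPower.map i (Matrix.toLin' (M * M')))
      = (wedgeEquiv d i).conj (exteriorPower.map i (Matrix.toLin' M)) *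
        (wedgeEquiv d i).conj (exteriorPower.map i (Matrix.toLin' M')) := by
    rw [Matrix.toLin'_mul, exteriorPower.map_comp, LinearEquiv.conj_comp]; rfl
  have h2 := congrArg (fun f : Module.End ℂ (WedgeSpace d i) => f (EuclideanSpace.single J 1) I) h1
  simp only [Module.End.mul_apply, wedgeEquiv_conj_map_apply] at h2
  simpa [Matrix.mul_apply] using h2

theorem compound_mul_real (i : ℕ) (M M' : Matrix (Fin d) (Fin d) ℝ) :
    compound i (M * M') = compound i M * compound i M' := by
  have h := compound_mul_complex i (M.map Complex.ofRealHom) (M'.map Complex.ofRealHom)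
  rw [← Matrix.map_mul, compound_map, compound_map, compound_map, ← Matrix.map_mul] at h
  ext I J
  exact Complex.ofRealHom.injective (congrFun (congrFun h I) J)

/-- Every matrix unit is the compound of a partial permutation matrix. -/
theorem exists_compound_eq_single {i : ℕ} (I J : Set.powersetCard (Fin d) i) :
    ∃ M : Matrix (Fin d) (Fin d) R, compound i M = Matrix.single I J 1 := by
  classical
  set e := ofFinEmbEquiv.symm I
  set f := ofFinEmbEquiv.symm J
  -- Ones are placed at the positions `(e k, f k)`, so the minor `I, J` is that of the identity. A
  -- different row set of the same size contains an index outside `I`, which gives a zero row;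
  -- likewise for columns.
  refine ⟨Matrix.of fun a b => if ∃ k, e k = a ∧ f k = b then 1 else 0, ?_⟩
  ext K L
  rw [compound_apply]
  by_cases hK : I = K
  · by_cases hL : J = L
    · subst hK hL
      rw [Matrix.single_apply, if_pos ⟨rfl, rfl⟩]
      suffices h : (Matrix.of fun a b => if ∃ k, e k = a ∧ f k = b then (1 : R) else 0).submatrix
          e f = 1 by
        rw [h, Matrix.det_one]
      ext k l
      rw [Matrix.submatrix_apply, Matrix.of_apply, Matrix.one_apply]
      refine if_congr ⟨?_, ?_⟩ rfl rfl
      · rintro ⟨k', h1, h2⟩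
        exact (e.injective h1).symm.trans (f.injective h2)
      · rintro rfl
        exact ⟨k, rfl, rfl⟩
    · rw [Matrix.single_apply, if_neg fun h => hL h.2]
      obtain ⟨a, haL, haJ⟩ := (exists_mem_notMem_iff_ne L J).1 (Ne.symm hL)
      obtain ⟨l, rfl⟩ := (mem_range_ofFinEmbEquiv_symm_iff_mem L a).2 haL
      refine Matrix.det_eq_zero_of_column_eq_zero l fun k => ?_
      rw [Matrix.submatrix_apply, Matrix.of_apply, if_neg]
      rintro ⟨k', -, h2⟩
      exact haJ ((mem_range_ofFinEmbEquiv_symm_iff_mem J _).1 ⟨k', h2⟩)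
  · rw [Matrix.single_apply, if_neg fun h => hK h.1]
    obtain ⟨a, haK, haI⟩ := (exists_mem_notMem_iff_ne K I).1 (Ne.symm hK)
    obtain ⟨l, rfl⟩ := (mem_range_ofFinEmbEquiv_symm_iff_mem K a).2 haK
    refine Matrix.det_eq_zero_of_row_eq_zero l fun k => ?_
    rw [Matrix.submatrix_apply, Matrix.of_apply, if_neg]
    rintro ⟨k', h1, -⟩
    exact haI ((mem_range_ofFinEmbEquiv_symm_iff_mem I _).1 ⟨k', h1⟩)

end Compound

/-! ### Bounded words span the orbit of the group -/

section Orbit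

variable {F X G : Type*} [Field F] [AddCommGroup X] [Module F X] [FiniteDimensional F X] [Group G]

/-- The span of an orbit of the group generated by `S` is already spanned by the words of length
`N`, as soon as `N` is at least the dimension. -/
theorem mem_span_image_pow (L : G → X →ₗ[F] X) (x : G → X) (hL : ∀ g h, L g (x h) = x (g * h))
    {S : Set G} (h1 : 1 ∈ S) {N : ℕ} (hN : Module.finrank F X ≤ N) {γ : G}
    (hγ : γ ∈ Subgroup.closure S) : x γ ∈ Submodule.span F (x '' S ^ N) := by
  set V : ℕ → Submodule F X := fun k => Submodule.span F (x '' S ^ k) with hV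
  have hmono : Monotone V := fun a b hab =>
    Submodule.span_mono (R := F) (Set.image_mono (Set.pow_subset_pow_right h1 hab))
  -- Otherwise `V 0 < V 1 < ⋯ < V (N + 1)` would force dimension at least `N + 1`.
  obtain ⟨k, hkN, hk⟩ : ∃ k ≤ N, V k = V (k + 1) := by
    by_contra! hne
    have hlt : ∀ k ≤ N + 1, k ≤ Module.finrank F (V k) := by
      intro k
      induction k with
      | zero => intro _; exact Nat.zero_le _
      | succ k ih =>
        intro hk
        have h2 : V k < V (k + 1) := lt_of_le_of_ne (hmono (Nat.le_succ k)) (hne k (by omega))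
        have h3 := Submodule.finrank_lt_finrank_of_lt (K := F) (V := X) h2
        have h4 := ih (by omega)
        omega
    have h2 := hlt (N + 1) le_rfl
    have h3 := Submodule.finrank_le (R := F) (V (N + 1))
    omega
  have hmem : ∀ v ∈ V k, v ∈ Submodule.span F (Set.range x) := fun v hv =>
    Submodule.span_mono (R := F) (Set.image_subset_range _ _) hv
  -- `L` is not assumed to be a representation; `hL` makes it multiplicative only on the span of the
  -- orbit, which contains `V k`.
  have hmul : ∀ g h, ∀ v ∈ V k, L (g * h) v = L g (L h v) := by
    intro g h v hv
    have : Set.EqOn (L (g * h)) (L g ∘ₗ L h) (Set.range x) := by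
      rintro _ ⟨y, rfl⟩
      simp [hL, mul_assoc]
    exact LinearMap.eqOn_span (R := F) this (hmem v hv)
  have hone : ∀ v ∈ V k, L 1 v = v := by
    intro v hv
    have : Set.EqOn (L 1) (LinearMap.id (R := F) (M := X)) (Set.range x) := by
      rintro _ ⟨y, rfl⟩
      simp [hL]
    exact LinearMap.eqOn_span (R := F) this (hmem v hv)
  have hS : ∀ s ∈ S, ∀ v ∈ V k, L s v ∈ V k := by
    intro s hs v hv
    have : V k ≤ (V k).comap (L s) := by
      refine Submodule.span_le.2 ?_
      rintro _ ⟨g, hg, rfl⟩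
      rw [SetLike.mem_coe, Submodule.mem_comap, hL, hk]
      refine Submodule.subset_span ⟨s * g, ?_, rfl⟩
      rw [pow_succ']
      exact Set.mul_mem_mul hs hg
    exact this hv
  have hcl : ∀ γ ∈ Subgroup.closure S, ∀ v ∈ V k, L γ v ∈ V k := by
    intro γ hγ
    induction hγ using Subgroup.closure_induction with
    | mem s hs => exact hS s hs
    | one => intro v hv; rwa [hone v hv]
    | mul a b _ _ ha hb => intro v hv; rw [hmul a b v hv]; exact ha _ (hb v hv)
    -- In finite dimension `L a` is injective, hence surjective, on `V k`, so its inverse also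
    -- preserves `V k`.
    | inv a _ ha =>
      intro v hv
      set f : V k →ₗ[F] V k := (L a).restrict ha with hf
      have hinj : Function.Injective f := by
        intro u w huw
        have h2 : L a u = L a w := congrArg Subtype.val huw
        have h3 := congrArg (L a⁻¹) h2
        rw [← hmul _ _ _ u.2, ← hmul _ _ _ w.2, inv_mul_cancel, hone _ u.2, hone _ w.2] at h3
        exact Subtype.ext h3
      obtain ⟨w, hw⟩ := LinearMap.injective_iff_surjective.1 hinj ⟨v, hv⟩
      have hw' : L a w = v := congrArg Subtype.val hw
      rw [← hw', ← hmul _ _ _ w.2, inv_mul_cancel, hone _ w.2]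
      exact w.2
  have hx1 : x 1 ∈ V k := by
    refine Submodule.subset_span ⟨1, ?_, rfl⟩
    simpa using Set.pow_subset_pow_right h1 (Nat.zero_le k) (by simp : (1 : G) ∈ S ^ 0)
  have h2 := hcl γ hγ (x 1) hx1
  rw [hL, mul_one] at h2
  exact hmono hkN h2

end Orbit

/-! ### Zariski density for products of minors -/

section MinorPairs

variable {d : ℕ} {R R' : Type*} [CommRing R] [CommRing R']

/-- The products of a minor of `M` and a minor of `M'`. -/
def minorPairs (i : ℕ) (M M' : Matrix (Fin d) (Fin d) R) :
    Set.powersetCard (Fin d) i × Set.powersetCard (Fin d) i ×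
      Set.powersetCard (Fin d) i × Set.powersetCard (Fin d) i → R :=
  fun k => compound i M k.1 k.2.1 * compound i M' k.2.2.1 k.2.2.2

/-- The action on pairs of minors that corresponds to left multiplication by `M`, where `M'` is the
inverse of `M`. -/
def minorPairsAction (i : ℕ) (M M' : Matrix (Fin d) (Fin d) ℝ) :
    (Set.powersetCard (Fin d) i × Set.powersetCard (Fin d) i ×
      Set.powersetCard (Fin d) i × Set.powersetCard (Fin d) i → ℝ) →ₗ[ℝ]
    (Set.powersetCard (Fin d) i × Set.powersetCard (Fin d) i ×
      Set.powersetCard (Fin d) i × Set.powersetCard (Fin d) i → ℝ) where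
  toFun v k := ∑ a, ∑ b, compound i M k.1 a * v (a, k.2.1, k.2.2.1, b) * compound i M' b k.2.2.2
  map_add' v w := by
    ext k
    simp only [Pi.add_apply, mul_add, add_mul, Finset.sum_add_distrib]
  map_smul' c v := by
    ext k
    simp only [Pi.smul_apply, smul_eq_mul, RingHom.id_apply, Finset.mul_sum]
    refine Finset.sum_congr rfl fun a _ => Finset.sum_congr rfl fun b _ => ?_
    ring

/-- Cauchy–Binet on both factors. The second matrix is multiplied on the right because inversion
reverses products. -/
theorem minorPairsAction_minorPairs (i : ℕ) (M M' N N' : Matrix (Fin d) (Fin d) ℝ) :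
    minorPairsAction i M M' (minorPairs i N N') = minorPairs i (M * N) (N' * M') := by
  ext k
  simp only [minorPairsAction, minorPairs, LinearMap.coe_mk, AddHom.coe_mk, compound_mul_real,
    Matrix.mul_apply, Finset.sum_mul_sum]
  refine Finset.sum_congr rfl fun a _ => Finset.sum_congr rfl fun b _ => ?_
  ring

theorem minorPairs_map (i : ℕ) (f : R →+* R') (M M' : Matrix (Fin d) (Fin d) R) (k) :
    minorPairs i (M.map f) (M'.map f) k = f (minorPairs i M M' k) := by
  simp [minorPairs, compound_map]

/-- If `S` generates a Zariski dense group, the pairs of minors of the words of length `N` span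
those of all elements of `SL_d(ℝ)`. -/
theorem minorPairs_mem_span {i N : ℕ} {S : Set SL(d, ℤ)} (h1 : 1 ∈ S)
    (hS : IsZariskiDense (Subgroup.closure S))
    (hN : Fintype.card (Set.powersetCard (Fin d) i) ^ 4 ≤ N) (g : SL(d, ℝ)) :
    minorPairs i g.1 (g⁻¹).1 ∈ Submodule.span ℝ
      ((fun γ : SL(d, ℤ) => minorPairs i (γ.1.map (Int.castRingHom ℝ))
        ((γ⁻¹).1.map (Int.castRingHom ℝ))) '' S ^ N) := by
  set x : SL(d, ℤ) → _ := fun γ : SL(d, ℤ) => minorPairs i (γ.1.map (Int.castRingHom ℝ))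
        ((γ⁻¹).1.map (Int.castRingHom ℝ)) with hx
  by_contra hg
  obtain ⟨f, hfg, hf⟩ := Submodule.exists_le_ker_of_notMem hg
  have hΓ : ∀ γ ∈ Subgroup.closure S, f (x γ) = 0 := by
    intro γ hγ
    refine hf (mem_span_image_pow (fun γ : SL(d, ℤ) => minorPairsAction i
      (γ.1.map (Int.castRingHom ℝ)) ((γ⁻¹).1.map (Int.castRingHom ℝ))) x ?_ h1 ?_ hγ)
    · intro a b
      simp only [hx, minorPairsAction_minorPairs, ← Matrix.map_mul, mul_inv_rev,
        Matrix.SpecialLinearGroup.coe_mul]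
    · rw [Module.finrank_fintype_fun_eq_card]
      simp only [Fintype.card_prod]
      refine le_trans (le_of_eq ?_) hN
      ring
  set Y : Matrix (Fin d) (Fin d) (MvPolynomial (Fin d × Fin d) ℝ) :=
    Matrix.mvPolynomialX (Fin d) (Fin d) ℝ with hY
  have hYe : ∀ M : Matrix (Fin d) (Fin d) ℝ,
      Y.map (MvPolynomial.eval fun ij : Fin d × Fin d => M ij.1 ij.2) = M := by
    intro M; ext a b; simp [hY, Matrix.mvPolynomialX]
  -- The separating form `f` becomes a polynomial in the entries once the inverse is replaced by the
  -- adjugate, which agrees with it in determinant 1.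
  set P : MvPolynomial (Fin d × Fin d) ℝ :=
    ∑ k, MvPolynomial.C (f (Pi.single k 1)) * minorPairs i Y Y.adjugate k with hP
  have hPe : ∀ M : Matrix (Fin d) (Fin d) ℝ,
      MvPolynomial.eval (fun ij : Fin d × Fin d => M ij.1 ij.2) P
        = f (minorPairs i M M.adjugate) := by
    intro M
    rw [LinearMap.pi_apply_eq_sum_univ f, hP, map_sum]
    refine Finset.sum_congr rfl fun k _ => ?_
    rw [map_mul, MvPolynomial.eval_C, ← minorPairs_map]
    have hadj : Y.adjugate.map (MvPolynomial.eval fun ij : Fin d × Fin d => M ij.1 ij.2)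
        = M.adjugate := by
      have := RingHom.map_adjugate (MvPolynomial.eval fun ij : Fin d × Fin d => M ij.1 ij.2) Y
      rw [RingHom.mapMatrix_apply, RingHom.mapMatrix_apply, hYe] at this
      exact this
    rw [hYe, hadj, smul_eq_mul, mul_comm]
    congr 2
    ext j
    simp [Pi.single_apply, eq_comm]
  refine hfg ?_
  have h2 := hS P (fun γ hγ => ?_) g
  · rw [hPe] at h2
    rwa [Matrix.SpecialLinearGroup.coe_inv]
  · have h3 := hPe (γ.1.map (Int.castRingHom ℝ))
    have h4 := hΓ γ hγ
    simp only [hx, Matrix.SpecialLinearGroup.coe_inv] at h4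
    have h5 := RingHom.map_adjugate (Int.castRingHom ℝ) γ.1
    rw [RingHom.mapMatrix_apply, RingHom.mapMatrix_apply] at h5
    rw [h5] at h4
    rw [h4] at h3
    exact h3

end MinorPairs

end VeryContracting

namespace VeryContracting

/-! ### Real matrices moving a vector off a hyperplane -/

section Nonvanishing

variable {d : ℕ}

theorem exists_pos_det_near_one (d : ℕ) : ∃ ε > 0, ∀ M : Matrix (Fin d) (Fin d) ℝ,
    (∀ a b, |M a b - (1 : Matrix (Fin d) (Fin d) ℝ) a b| < ε) → 0 < M.det := by
  have hc : Continuous fun f : Fin d → Fin d → ℝ => (Matrix.of f).det :=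
    Continuous.matrix_det continuous_id
  have ho := hc.isOpen_preimage _ (isOpen_Ioi (a := (0 : ℝ)))
  obtain ⟨ε, hε, hb⟩ := Metric.isOpen_iff.1 ho
    (fun a b => (1 : Matrix (Fin d) (Fin d) ℝ) a b) (by
    change (0 : ℝ) < (1 : Matrix (Fin d) (Fin d) ℝ).det
    simp)
  refine ⟨ε, hε, fun M hM => ?_⟩
  have hmem : (fun a b => M a b) ∈
      Metric.ball (fun a b => (1 : Matrix (Fin d) (Fin d) ℝ) a b) ε := by
    rw [Metric.mem_ball, dist_pi_lt_iff hε]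
    intro a
    rw [dist_pi_lt_iff hε]
    intro b
    rw [Real.dist_eq]
    exact hM a b
  exact hb hmem

/-- Both conditions are given by nonzero polynomials in the entries of an arbitrary matrix, with the
adjugate in place of the inverse. Their product is nonzero at some real matrix near the identity,
and scaling that matrix to determinant 1 only multiplies the two values by nonzero factors. -/
theorem exists_dotProduct_compound_ne_zero (hd : 2 ≤ d) {i : ℕ}
    {φ u : Set.powersetCard (Fin d) i → ℂ} (hφ : φ ≠ 0) (hu : u ≠ 0) :
    ∃ g : SL(d, ℝ), φ ⬝ᵥ (compound i (g.1.map Complex.ofRealHom)).mulVec u ≠ 0 ∧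
      φ ⬝ᵥ (compound i ((g⁻¹).1.map Complex.ofRealHom)).mulVec u ≠ 0 := by
  classical
  set Y : Matrix (Fin d) (Fin d) (MvPolynomial (Fin d × Fin d) ℂ) :=
    Matrix.mvPolynomialX (Fin d) (Fin d) ℂ with hY
  have hYe : ∀ x : Fin d × Fin d → ℂ,
      Y.map (MvPolynomial.eval x) = Matrix.of fun a b => x (a, b) := by
    intro x; ext a b; simp [hY, Matrix.mvPolynomialX]
  set p : Matrix (Fin d) (Fin d) (MvPolynomial (Fin d × Fin d) ℂ) → MvPolynomial (Fin d × Fin d) ℂ :=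
    fun Z => (MvPolynomial.C ∘ φ) ⬝ᵥ (compound i Z).mulVec (MvPolynomial.C ∘ u) with hp
  have hpe : ∀ Z x, MvPolynomial.eval x (p Z)
      = φ ⬝ᵥ (compound i (Z.map (MvPolynomial.eval x))).mulVec u := by
    intro Z x
    have h1 : ∀ w : Set.powersetCard (Fin d) i → ℂ,
        (MvPolynomial.eval x) ∘ (MvPolynomial.C (σ := Fin d × Fin d)) ∘ w = w := by
      intro w; ext; simp
    have h2 : (MvPolynomial.eval x) ∘ ((compound i Z).mulVec (MvPolynomial.C ∘ u))
        = (compound i (Z.map (MvPolynomial.eval x))).mulVec u := by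
      ext I
      rw [Function.comp_apply, RingHom.map_mulVec, h1, compound_map]
    rw [hp, RingHom.map_dotProduct, h1, h2]
  have hadj : ∀ x, Y.adjugate.map (MvPolynomial.eval x)
      = (Matrix.of fun a b => x (a, b) : Matrix (Fin d) (Fin d) ℂ).adjugate := by
    intro x
    have := RingHom.map_adjugate (MvPolynomial.eval x) Y
    rw [RingHom.mapMatrix_apply, RingHom.mapMatrix_apply, hYe] at this
    exact this
  have hp1 : p Y ≠ 0 := by
    obtain ⟨I, hI⟩ := Function.ne_iff.1 hφ
    obtain ⟨J, hJ⟩ := Function.ne_iff.1 hu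
    obtain ⟨M, hM⟩ := exists_compound_eq_single (R := ℂ) I J
    intro h
    have h2 := hpe Y fun ij => M ij.1 ij.2
    rw [h, hYe, map_zero] at h2
    change 0 = φ ⬝ᵥ (compound i M).mulVec u at h2
    rw [hM, Matrix.single_mulVec] at h2
    simp [Function.update_apply, dotProduct] at h2
    exact h2.elim hI hJ
  have hp2 : p Y.adjugate ≠ 0 := by
    intro h
    -- The adjugate of the adjugate is `det^(d-2)` times the matrix, so vanishing of the second
    -- polynomial would force vanishing of the first.
    have h1 : p Y * Y.det ^ ((d - 2) * i) = 0 := by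
      refine MvPolynomial.funext fun x => ?_
      set M : Matrix (Fin d) (Fin d) ℂ := Matrix.of fun a b => x (a, b) with hM
      have h2 := hpe Y.adjugate fun ij => M.adjugate ij.1 ij.2
      rw [h, hadj, map_zero] at h2
      change 0 = φ ⬝ᵥ (compound i M.adjugate.adjugate).mulVec u at h2
      rw [Matrix.adjugate_adjugate _ (by rw [Fintype.card_fin]; omega), compound_smul,
        Matrix.smul_mulVec, dotProduct_smul, smul_eq_mul, Fintype.card_fin, ← pow_mul] at h2
      have hdet : MvPolynomial.eval x Y.det = M.det := by
        rw [RingHom.map_det, RingHom.mapMatrix_apply, hYe]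
      rw [map_mul, map_pow, map_zero, hpe, hYe, hdet, mul_comm]
      exact h2.symm
    rcases mul_eq_zero.1 h1 with h2 | h2
    · exact hp1 h2
    · exact pow_ne_zero _ (Matrix.det_mvPolynomialX_ne_zero (Fin d) ℂ) h2
  obtain ⟨ε, hε, hdet⟩ := exists_pos_det_near_one d
  -- A nonzero polynomial cannot vanish on a product of infinite sets, here real intervals around
  -- the entries of the identity.
  obtain ⟨x, hx, hne⟩ : ∃ x ∈ Set.pi Set.univ (fun ij : Fin d × Fin d => Complex.ofReal ''
      Set.Ioo ((1 : Matrix (Fin d) (Fin d) ℝ) ij.1 ij.2 - ε) ((1 : Matrix _ _ ℝ) ij.1 ij.2 + ε)),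
      MvPolynomial.eval x (p Y * p Y.adjugate) ≠ 0 := by
    by_contra! hall
    refine mul_ne_zero hp1 hp2 (MvPolynomial.funext_set
      (fun ij : Fin d × Fin d => Complex.ofReal '' Set.Ioo
        ((1 : Matrix (Fin d) (Fin d) ℝ) ij.1 ij.2 - ε) ((1 : Matrix _ _ ℝ) ij.1 ij.2 + ε))
      (fun ij => ?_) fun x hx => ?_)
    · exact (Set.Ioo_infinite (by linarith)).image Complex.ofReal_injective.injOn
    · rw [hall x hx, map_zero]
  have hx' : ∀ ij : Fin d × Fin d, ∃ y : ℝ, |y - (1 : Matrix (Fin d) (Fin d) ℝ) ij.1 ij.2| < ε ∧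
      (y : ℂ) = x ij := by
    intro ij
    obtain ⟨y, hy, hyx⟩ := hx ij (Set.mem_univ _)
    refine ⟨y, ?_, hyx⟩
    rw [abs_lt]
    constructor <;> linarith [hy.1, hy.2]
  choose y hy hyx using hx'
  set M : Matrix (Fin d) (Fin d) ℝ := Matrix.of fun a b => y (a, b) with hM
  have hMdet : 0 < M.det := hdet M fun a b => hy (a, b)
  have hMx : (Matrix.of fun a b => x (a, b) : Matrix (Fin d) (Fin d) ℂ)
      = M.map Complex.ofRealHom := by
    ext a b
    exact (hyx (a, b)).symm
  rw [map_mul, hpe, hpe, hYe, hadj, hMx] at hne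
  set c : ℝ := M.det ^ (-(1 / d : ℝ)) with hc
  have hc0 : 0 < c := Real.rpow_pos_of_pos hMdet _
  have hcd : c ^ d * M.det = 1 := by
    rw [hc, ← Real.rpow_natCast, ← Real.rpow_mul hMdet.le, neg_mul, one_div,
      inv_mul_cancel₀ (by positivity), Real.rpow_neg_one, inv_mul_cancel₀ hMdet.ne']
  refine ⟨⟨c • M, by rw [Matrix.det_smul, Fintype.card_fin, hcd]⟩, ?_, ?_⟩
  · have h1 : (c • M).map Complex.ofRealHom = (c : ℂ) • M.map Complex.ofRealHom := by
      ext a b; simp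
    change φ ⬝ᵥ (compound i ((c • M).map Complex.ofRealHom)).mulVec u ≠ 0
    rw [h1, compound_smul, Matrix.smul_mulVec, dotProduct_smul, smul_eq_mul]
    exact mul_ne_zero (pow_ne_zero _ (by exact_mod_cast hc0.ne')) (left_ne_zero_of_mul hne)
  · change φ ⬝ᵥ (compound i ((c • M).adjugate.map Complex.ofRealHom)).mulVec u ≠ 0
    have h1 : (c • M).adjugate.map Complex.ofRealHom
        = ((c ^ (d - 1) : ℝ) : ℂ) • (M.map Complex.ofRealHom).adjugate := by
      have h2 := RingHom.map_adjugate Complex.ofRealHom M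
      rw [RingHom.mapMatrix_apply, RingHom.mapMatrix_apply] at h2
      rw [← h2, Matrix.adjugate_smul, Fintype.card_fin]
      ext a b; simp
    rw [h1, compound_smul, Matrix.smul_mulVec, dotProduct_smul, smul_eq_mul]
    exact mul_ne_zero (pow_ne_zero _ (by exact_mod_cast (pow_pos hc0 _).ne'))
      (right_ne_zero_of_mul hne)

/-- Compactness: finitely many elements of `SL_d(ℝ)` suffice to move any unit vector away from any
hyperplane, together with their inverses, by a uniform amount. -/
theorem exists_finset_forall_le (hd : 2 ≤ d) (i : ℕ) :
    ∃ (G₀ : Finset SL(d, ℝ)) (c : ℝ), 0 < c ∧ ∀ φ u : WedgeSpace d i, ‖φ‖ = 1 → ‖u‖ = 1 →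
      ∃ g ∈ G₀, c ≤ ‖φ.ofLp ⬝ᵥ (compound i (g.1.map Complex.ofRealHom)).mulVec u.ofLp‖ *
        ‖φ.ofLp ⬝ᵥ (compound i ((g⁻¹).1.map Complex.ofRealHom)).mulVec u.ofLp‖ := by
  classical
  set f : SL(d, ℝ) → WedgeSpace d i × WedgeSpace d i → ℝ := fun g z =>
    ‖z.1.ofLp ⬝ᵥ (compound i (g.1.map Complex.ofRealHom)).mulVec z.2.ofLp‖ *
        ‖z.1.ofLp ⬝ᵥ (compound i ((g⁻¹).1.map Complex.ofRealHom)).mulVec z.2.ofLp‖ with hf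
  have hfc : ∀ g, Continuous (f g) := by
    intro g
    simp only [hf, dotProduct, Matrix.mulVec]
    fun_prop
  have hK : IsCompact ((Metric.sphere (0 : WedgeSpace d i) 1) ×ˢ
      (Metric.sphere (0 : WedgeSpace d i) 1)) := (isCompact_sphere _ _).prod (isCompact_sphere _ _)
  have key : ∃ (G₀ : Finset SL(d, ℝ)) (c : ℝ), 0 < c ∧
      ∀ z ∈ (Metric.sphere (0 : WedgeSpace d i) 1) ×ˢ (Metric.sphere (0 : WedgeSpace d i) 1),
        ∃ g ∈ G₀, c ≤ f g z := by
    -- The property passes to subsets and to unions of two sets, and holds near each point by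
    -- continuity; compactness makes it global.
    refine hK.induction_on (p := fun s => ∃ (G₀ : Finset SL(d, ℝ)) (c : ℝ), 0 < c ∧
      ∀ z ∈ s, ∃ g ∈ G₀, c ≤ f g z) ⟨∅, 1, one_pos, by simp⟩ ?_ ?_ ?_
    · rintro s t hst ⟨G₀, c, hc, h⟩
      exact ⟨G₀, c, hc, fun z hz => h z (hst hz)⟩
    · rintro s t ⟨G₁, c₁, hc₁, h₁⟩ ⟨G₂, c₂, hc₂, h₂⟩
      refine ⟨G₁ ∪ G₂, min c₁ c₂, lt_min hc₁ hc₂, fun z hz => ?_⟩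
      rcases hz with hz | hz
      · obtain ⟨g, hg, h⟩ := h₁ z hz
        exact ⟨g, Finset.mem_union_left _ hg, (min_le_left _ _).trans h⟩
      · obtain ⟨g, hg, h⟩ := h₂ z hz
        exact ⟨g, Finset.mem_union_right _ hg, (min_le_right _ _).trans h⟩
    · rintro ⟨φ, u⟩ ⟨hφ, hu⟩
      have hne : ∀ w : WedgeSpace d i, w ∈ Metric.sphere (0 : WedgeSpace d i) 1 → w.ofLp ≠ 0 := by
        intro w hw h
        have : w = 0 := by ext I; exact congrFun h I
        rw [this] at hw
        simp at hw
      obtain ⟨g, h1, h2⟩ := exists_dotProduct_compound_ne_zero hd (hne φ hφ) (hne u hu)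
      have hpos : 0 < f g (φ, u) := mul_pos (norm_pos_iff.2 h1) (norm_pos_iff.2 h2)
      refine ⟨{z | f g (φ, u) / 2 < f g z}, mem_nhdsWithin_of_mem_nhds
        ((hfc g).continuousAt.eventually_const_lt (half_lt_self hpos)),
        {g}, f g (φ, u) / 2, half_pos hpos, fun z hz => ⟨g, Finset.mem_singleton_self _, hz.le⟩⟩
  obtain ⟨G₀, c, hc, h⟩ := key
  exact ⟨G₀, c, hc, fun φ u hφ hu => h (φ, u) ⟨by simpa using hφ, by simpa using hu⟩⟩

end Nonvanishing

/-! ### Integral vectors and Cramer's rule -/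

section Gram

open scoped Nat

variable {κ : Type*} [Fintype κ]

/-- A linear form that is small on a set of bounded integer vectors is small on its real span: by
Cramer's rule and the integrality of the Gram determinant, coefficients are bounded. -/
theorem norm_le_of_mem_span_of_integral {Y : Set (κ → ℝ)} (hY : ∀ y ∈ Y, ∀ k, ∃ z : ℤ, y k = z)
    {M M' δ : ℝ} (hM : 1 ≤ M) (hYM : ∀ y ∈ Y, ∀ k, |y k| ≤ M) {w : κ → ℝ}
    (hw : w ∈ Submodule.span ℝ Y) (hM'0 : 0 ≤ M') (hwM : ∀ k, |w k| ≤ M') (f : (κ → ℝ) →ₗ[ℝ] ℂ)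
    (hδ0 : 0 ≤ δ) (hδ : ∀ y ∈ Y, ‖f y‖ ≤ δ) :
    ‖f w‖ ≤ Fintype.card κ * (Fintype.card κ * ((Fintype.card κ)! *
      ((Fintype.card κ + 1) * M ^ 2) ^ Fintype.card κ * (Fintype.card κ * (M * M')))) * δ := by
  classical
  obtain ⟨b, hbY, hspan, hli⟩ := exists_linearIndependent ℝ Y
  have : Fintype b := hli.setFinite.fintype
  have hD : Fintype.card b ≤ Fintype.card κ := by
    have := hli.fintype_card_le_finrank
    rwa [Module.finrank_fintype_fun_eq_card] at this
  set n := Fintype.card κ with hn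
  choose z hz using fun (y : b) (k : κ) => hY y (hbY y.2) k
  set Z : Matrix b κ ℤ := Matrix.of z with hZ
  set A : Matrix b κ ℝ := Matrix.of fun y k => (y : κ → ℝ) k with hA
  have hAZ : A = Z.map (Int.castRingHom ℝ) := by
    ext y k; simp [hA, hZ, hz]
  set G : Matrix b b ℝ := A * A.transpose with hG
  have hGpos : 0 < G.det := by
    have : (A * A.conjTranspose).PosDef := by
      refine Matrix.PosDef.mul_conjTranspose_self A ?_
      rw [Matrix.vecMul_injective_iff]
      exact hli
    rw [Matrix.conjTranspose_eq_transpose_of_trivial] at this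
    exact this.det_pos
  -- The basis `b` is chosen inside `Y`, so `G` is an integer matrix; being positive, its
  -- determinant is at least 1.
  have hGdet : 1 ≤ G.det := by
    have h1 : G.det = ((Z * Z.transpose).det : ℤ) := by
      rw [hG, hAZ, ← Matrix.transpose_map, ← Matrix.map_mul]
      exact (RingHom.map_det (Int.castRingHom ℝ) (Z * Z.transpose)).symm
    rw [h1] at hGpos ⊢
    exact_mod_cast Int.add_one_le_iff.2 (Int.cast_pos.1 hGpos)
  obtain ⟨c, hc⟩ : ∃ c : b → ℝ, ∑ y, c y • (y : κ → ℝ) = w := by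
    rw [← hspan, ← Subtype.range_coe (s := b)] at hw
    exact (Submodule.mem_span_range_iff_exists_fun ℝ).1 hw
  have hwA : w = A.transpose.mulVec c := by
    rw [← hc]; ext k
    simp [Matrix.mulVec, dotProduct, hA, mul_comm]
  -- Cramer's rule for the normal equations `G c = A w`; since `det G ≥ 1`, no division can enlarge
  -- the coefficients.
  have hGc : G.adjugate.mulVec (A.mulVec w) = G.det • c := by
    have h1 : A.mulVec (A.transpose.mulVec c) = G.mulVec c := Matrix.mulVec_mulVec ..
    rw [hwA, h1, Matrix.mulVec_mulVec, Matrix.adjugate_mul, Matrix.smul_mulVec, Matrix.one_mulVec]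
  have hAw : ∀ y, |A.mulVec w y| ≤ n * (M * M') := by
    intro y
    refine (Finset.abs_sum_le_sum_abs _ _).trans ?_
    rw [hn, ← nsmul_eq_mul]
    refine Finset.sum_le_card_nsmul _ _ _ fun k _ => ?_
    rw [abs_mul]
    exact mul_le_mul (hYM _ (hbY y.2) k) (hwM k) (abs_nonneg _) (by linarith)
  -- With `n + 1` instead of `n` one has `e ≥ 1` even if `n = 0`. This covers the 0–1 row in the
  -- adjugate and lets the exponent grow from `Fintype.card b` to `n`.
  set e : ℝ := (n + 1) * M ^ 2 with he
  have hM2 : 1 ≤ M ^ 2 := one_le_pow₀ hM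
  have he1 : 1 ≤ e := by
    have : (0 : ℝ) ≤ n := Nat.cast_nonneg n
    nlinarith
  have hGe : ∀ y y', |G y y'| ≤ e := by
    intro y y'
    have h1 : |G y y'| ≤ n * M ^ 2 := by
      refine (Finset.abs_sum_le_sum_abs _ _).trans ?_
      rw [hn, ← nsmul_eq_mul]
      refine Finset.sum_le_card_nsmul _ _ _ fun k _ => ?_
      rw [abs_mul, sq]
      exact mul_le_mul (hYM _ (hbY y.2) k) (hYM _ (hbY y'.2) k) (abs_nonneg _) (by linarith)
    refine h1.trans ?_
    rw [he]; nlinarith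
  have hadj : ∀ y y', |G.adjugate y y'| ≤ n ! * e ^ n := by
    intro y y'
    rw [Matrix.adjugate_apply]
    have h1 := Matrix.det_le (A := G.updateRow y' (Pi.single y 1)) (abv := AbsoluteValue.abs)
      (x := e) (fun a a' => by
        rw [Matrix.updateRow_apply]
        split_ifs
        · rw [Pi.single_apply]
          split_ifs
          · simpa using he1
          · simpa using zero_le_one.trans he1
        · exact hGe a a')
    refine (show |_| ≤ _ from h1).trans ?_
    rw [nsmul_eq_mul]
    gcongr
  have hcb : ∀ y, |c y| ≤ n * (n ! * e ^ n * (n * (M * M'))) := by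
    intro y
    have h1 : |c y| ≤ |G.adjugate.mulVec (A.mulVec w) y| := by
      rw [hGc, Pi.smul_apply, smul_eq_mul, abs_mul, abs_of_pos hGpos]
      exact le_mul_of_one_le_left (abs_nonneg _) hGdet
    refine h1.trans ((Finset.abs_sum_le_sum_abs _ _).trans ?_)
    have h2 : ∑ y', |G.adjugate y y' * A.mulVec w y'|
        ≤ Fintype.card b • (n ! * e ^ n * (n * (M * M'))) := by
      refine Finset.sum_le_card_nsmul _ _ _ fun y' _ => ?_
      rw [abs_mul]
      exact mul_le_mul (hadj y y') (hAw y') (abs_nonneg _) (by positivity)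
    refine h2.trans ?_
    rw [nsmul_eq_mul]
    gcongr
  rw [← hc, map_sum]
  refine (norm_sum_le _ _).trans ?_
  have h3 : ∑ y : b, ‖f (c y • (y : κ → ℝ))‖
      ≤ Fintype.card b • ((n * (n ! * e ^ n * (n * (M * M')))) * δ) := by
    refine Finset.sum_le_card_nsmul _ _ _ fun y _ => ?_
    rw [map_smul, norm_smul, Real.norm_eq_abs]
    exact mul_le_mul (hcb y) (hδ _ (hbY y.2)) (norm_nonneg _) (by positivity)
  refine h3.trans ?_
  calc _ = (Fintype.card b : ℝ) * ((n * (n ! * e ^ n * (n * (M * M')))) * δ) := nsmul_eq_mul _ _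
    _ ≤ (n : ℝ) * ((n * (n ! * e ^ n * (n * (M * M')))) * δ) := by gcongr
    _ = _ := by ring

end Gram

/-! ### Quantitative escape from hyperplanes -/

section Escape

variable {d : ℕ}

/-- The linear form on pairs of minors whose value at those of `g` and `g⁻¹` is
`φ (g u) * φ (g⁻¹ u)`. -/
def minorPairsForm {i : ℕ} (φ u : Set.powersetCard (Fin d) i → ℂ) :
    (Set.powersetCard (Fin d) i × Set.powersetCard (Fin d) i ×
      Set.powersetCard (Fin d) i × Set.powersetCard (Fin d) i → ℝ) →ₗ[ℝ] ℂ where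
  toFun v := ∑ k, (φ k.1 * u k.2.1 * φ k.2.2.1 * u k.2.2.2) * (v k : ℂ)
  map_add' v w := by
    simp only [Pi.add_apply, Complex.ofReal_add, mul_add, Finset.sum_add_distrib]
  map_smul' c v := by
    simp only [Pi.smul_apply, smul_eq_mul, Complex.ofReal_mul, RingHom.id_apply, Finset.smul_sum,
      Complex.real_smul]
    refine Finset.sum_congr rfl fun k _ => ?_
    ring

theorem minorPairsForm_minorPairs {i : ℕ} (φ u : Set.powersetCard (Fin d) i → ℂ)
    (M M' : Matrix (Fin d) (Fin d) ℝ) :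
    minorPairsForm φ u (minorPairs i M M') =
      (φ ⬝ᵥ (compound i (M.map Complex.ofRealHom)).mulVec u) *
        (φ ⬝ᵥ (compound i (M'.map Complex.ofRealHom)).mulVec u) := by
  have h : ∀ N : Matrix (Fin d) (Fin d) ℝ,
      φ ⬝ᵥ (compound i (N.map Complex.ofRealHom)).mulVec u
        = ∑ I, ∑ J, φ I * u J * ((compound i N I J : ℝ) : ℂ) := by
    intro N
    simp only [dotProduct, Matrix.mulVec, Finset.mul_sum, compound_map, Matrix.map_apply,
      Complex.ofRealHom_eq_coe]
    exact Finset.sum_congr rfl fun I _ => Finset.sum_congr rfl fun J _ => by ring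
  rw [h, h, Finset.sum_mul]
  simp only [minorPairsForm, minorPairs, LinearMap.coe_mk, AddHom.coe_mk, Fintype.sum_prod_type]
  refine Finset.sum_congr rfl fun I _ => ?_
  rw [Finset.sum_mul]
  refine Finset.sum_congr rfl fun J _ => ?_
  rw [Finset.mul_sum]
  refine Finset.sum_congr rfl fun K _ => ?_
  rw [Finset.mul_sum]
  refine Finset.sum_congr rfl fun L _ => ?_
  push_cast
  ring

/-- Quantitative escape from hyperplanes: if `S` generates a Zariski dense group and the minors of
words of length `N` are at most `M`, then some word moves `u` away from the kernel of `φ`, as does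
its inverse, by an amount polynomial in `M`. -/
theorem exists_mem_pow_one_le (hd : 2 ≤ d) (i : ℕ) : ∃ (C : ℝ) (k : ℕ), 0 < C ∧
    ∀ (N : ℕ), Fintype.card (Set.powersetCard (Fin d) i) ^ 4 ≤ N → ∀ S : Set SL(d, ℤ), 1 ∈ S →
      IsZariskiDense (Subgroup.closure S) → ∀ M : ℝ, 1 ≤ M →
      (∀ γ ∈ S ^ N, ∀ k, |minorPairs i (γ.1.map (Int.castRingHom ℝ))
        ((γ⁻¹).1.map (Int.castRingHom ℝ)) k| ≤ M) →
      ∀ φ u : WedgeSpace d i, ‖φ‖ = 1 → ‖u‖ = 1 → ∃ γ ∈ S ^ N,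
        1 ≤ C * M ^ k *
          (‖φ.ofLp ⬝ᵥ (compound i (γ.1.map (Int.cast : ℤ → ℂ))).mulVec u.ofLp‖ *
            ‖φ.ofLp ⬝ᵥ (compound i ((γ⁻¹).1.map (Int.cast : ℤ → ℂ))).mulVec u.ofLp‖) := by
  classical
  obtain ⟨G₀, c₀, hc₀, hG₀⟩ := exists_finset_forall_le hd i
  obtain ⟨M', hM'0, hM'⟩ : ∃ M' : ℝ, 0 ≤ M' ∧ ∀ g ∈ G₀, ∀ k,
      |minorPairs i g.1 (g⁻¹).1 k| ≤ M' := by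
    refine ⟨∑ g ∈ G₀, ∑ k, |minorPairs i g.1 (g⁻¹).1 k|,
      Finset.sum_nonneg fun g _ => Finset.sum_nonneg fun k _ => abs_nonneg _, fun g hg k => ?_⟩
    refine le_trans ?_ (Finset.single_le_sum
      (f := fun g : SL(d, ℝ) => ∑ k, |minorPairs i g.1 (g⁻¹).1 k|)
      (fun g _ => Finset.sum_nonneg fun k _ => abs_nonneg _) hg)
    exact Finset.single_le_sum (f := fun k => |minorPairs i g.1 (g⁻¹).1 k|)
      (fun k _ => abs_nonneg _) (Finset.mem_univ k)
  set n := Fintype.card (Set.powersetCard (Fin d) i × Set.powersetCard (Fin d) i ×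
      Set.powersetCard (Fin d) i × Set.powersetCard (Fin d) i) with hn
  -- The constant of `norm_le_of_mem_span_of_integral` without its powers of `M`, which amount to `M
  -- ^ (2 * n + 1)`.
  set C₀ : ℝ := n * (n * (n.factorial * (n + 1) ^ n * n)) * M' with hC₀
  have hC₀0 : 0 ≤ C₀ := by positivity
  refine ⟨(C₀ + 1) / c₀, 2 * n + 1, by positivity, ?_⟩
  intro N hN S h1 hS M hM hSM φ u hφ hu
  by_contra! hall
  have hMpos : 0 < M := by linarith
  -- Chosen so that a form at most `δ` on all words is smaller than `c₀` on their span,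
  -- contradicting its value at `g`.
  set δ : ℝ := c₀ / ((C₀ + 1) * M ^ (2 * n + 1)) with hδ
  have hδ0 : 0 < δ := by positivity
  obtain ⟨g, hg, hcg⟩ := hG₀ φ u hφ hu
  rw [← norm_mul, ← minorPairsForm_minorPairs] at hcg
  have hcast : ∀ γ : SL(d, ℤ), γ.1.map (Int.cast : ℤ → ℂ)
      = (γ.1.map (Int.castRingHom ℝ)).map Complex.ofRealHom := by
    intro γ; ext a b; simp
  have hle := norm_le_of_mem_span_of_integral (δ := δ) ?_ hM ?_ (minorPairs_mem_span h1 hS hN g)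
    hM'0 (hM' g hg) (minorPairsForm φ.ofLp u.ofLp) hδ0.le ?_
  · have h2 : c₀ ≤ C₀ * M ^ (2 * n + 1) * δ := by
      refine hcg.trans (hle.trans (le_of_eq ?_))
      rw [← hn, hC₀, mul_pow, ← pow_mul]
      ring
    have h3 : (C₀ + 1) * M ^ (2 * n + 1) * δ = c₀ := by
      rw [hδ]; field_simp
    nlinarith [mul_pos (pow_pos hMpos (2 * n + 1)) hδ0]
  · rintro _ ⟨γ, -, rfl⟩ k
    exact ⟨_, minorPairs_map i (Int.castRingHom ℝ) γ.1 (γ⁻¹).1 k⟩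
  · rintro _ ⟨γ, hγ, rfl⟩ k
    exact hSM γ hγ k
  · rintro _ ⟨γ, hγ, rfl⟩
    simp only
    have h2 := hall γ hγ
    rw [hcast, hcast, ← norm_mul, ← minorPairsForm_minorPairs] at h2
    rw [hδ, le_div_iff₀ (by positivity)]
    rw [div_mul_eq_mul_div, div_mul_eq_mul_div, div_lt_one hc₀] at h2
    linarith

end Escape

end VeryContracting

namespace VeryContracting

/-! ### Operator norms and the uniform spectral gap -/

section OpNorm

variable {d : ℕ}

theorem abs_entry_le_opNorm (g : SL(d, ℤ)) (a b : Fin d) : |((g.1 a b : ℤ) : ℝ)| ≤ opNorm g := by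
  set T := Matrix.toEuclideanCLM (n := Fin d) (𝕜 := ℝ) (g.1.map (Int.cast : ℤ → ℝ)) with hT
  have h1 : (T (EuclideanSpace.single b 1)) a = ((g.1 a b : ℤ) : ℝ) := by
    rw [hT]
    simp [Matrix.ofLp_toEuclideanCLM]
  rw [← h1, ← Real.norm_eq_abs]
  refine (PiLp.norm_apply_le _ a).trans ((T.le_opNorm _).trans (le_of_eq ?_))
  rw [PiLp.norm_single, norm_one, mul_one]
  rfl

theorem opNorm_mul_le (g h : SL(d, ℤ)) : opNorm (g * h) ≤ opNorm g * opNorm h := by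
  unfold opNorm
  have : ((g * h).1.map (Int.cast : ℤ → ℝ)) = g.1.map Int.cast * h.1.map Int.cast := by
    rw [Matrix.SpecialLinearGroup.coe_mul]
    exact Matrix.map_mul_intCast _ _
  rw [this, map_mul]
  exact norm_mul_le _ _

theorem opNorm_one_le : opNorm (1 : SL(d, ℤ)) ≤ 1 := by
  unfold opNorm
  have : ((1 : SL(d, ℤ)).1.map (Int.cast : ℤ → ℝ)) = 1 := by simp
  rw [this, map_one]
  exact ContinuousLinearMap.norm_id_le

theorem opNorm_nonneg (g : SL(d, ℤ)) : 0 ≤ opNorm g := norm_nonneg _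

theorem opNorm_le_pow_of_mem_pow {S : Set SL(d, ℤ)} {P : ℝ} (hP : 0 ≤ P)
    (hS : ∀ s ∈ S, opNorm s ≤ P) (N : ℕ) : ∀ γ ∈ S ^ N, opNorm γ ≤ P ^ N := by
  induction N with
  | zero =>
    intro γ hγ
    rw [pow_zero, Set.mem_one] at hγ
    rw [hγ, pow_zero]
    exact opNorm_one_le
  | succ N ih =>
    intro γ hγ
    rw [pow_succ] at hγ
    obtain ⟨a, ha, b, hb, rfl⟩ := Set.mem_mul.1 hγ
    rw [pow_succ]
    exact (opNorm_mul_le a b).trans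
      (mul_le_mul (ih a ha) (hS b hb) (opNorm_nonneg b) (pow_nonneg hP N))

theorem finite_setOf_opNorm_le (C : ℝ) : {g : SL(d, ℤ) | opNorm g ≤ C}.Finite := by
  have hfin : (Set.pi Set.univ fun _ : Fin d => Set.pi Set.univ fun _ : Fin d =>
      Set.Icc (-⌈C⌉) ⌈C⌉).Finite :=
    Set.Finite.pi fun _ => Set.Finite.pi fun _ => Set.finite_Icc _ _
  refine Set.Finite.subset (hfin.preimage (f := fun g : SL(d, ℤ) => fun a b => g.1 a b) ?_) ?_
  · intro g _ h _ hgh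
    exact Subtype.ext hgh
  · intro g hg a _ b _
    have h1 := (abs_entry_le_opNorm g a b).trans (hg.trans (Int.le_ceil C))
    have h2 : |g.1 a b| ≤ ⌈C⌉ := by exact_mod_cast h1
    exact abs_le.1 h2

/-- If all norms on `S` were at most 1, so would be those on the group: the powers of an element lie
in a finite set, so its inverse is one of its powers. Off-diagonal entries would then lie in `{-1,
0, 1}`, and `x³ - x` would vanish on the group but not on a transvection with entry 2. -/
theorem exists_one_lt_opNorm (hd : 2 ≤ d) {S : Set SL(d, ℤ)}
    (hS : IsZariskiDense (Subgroup.closure S)) : ∃ s ∈ S, 1 < opNorm s := by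
  by_contra! hle
  have hcl : ∀ γ ∈ Subgroup.closure S, opNorm γ ≤ 1 := by
    intro γ hγ
    induction hγ using Subgroup.closure_induction with
    | mem s hs => exact hle s hs
    | one => exact opNorm_one_le
    | mul a b _ _ ha hb =>
      exact (opNorm_mul_le a b).trans (mul_le_one₀ ha (opNorm_nonneg b) hb)
    | inv a _ ha =>
      have hpow : ∀ k : ℕ, opNorm (a ^ k) ≤ 1 := by
        intro k
        induction k with
        | zero => rw [pow_zero]; exact opNorm_one_le
        | succ k ih =>
          rw [pow_succ]
          exact (opNorm_mul_le _ _).trans (mul_le_one₀ ih (opNorm_nonneg a) ha)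
      have hfin : IsOfFinOrder a := by
        rw [← finite_powers]
        refine (finite_setOf_opNorm_le (d := d) 1).subset ?_
        rintro _ ⟨k, rfl⟩
        exact hpow k
      obtain ⟨k, hk⟩ := hfin.mem_powers_iff_mem_zpowers.2
        (Subgroup.inv_mem _ (Subgroup.mem_zpowers a))
      rw [← hk]
      exact hpow k
  set a : Fin d := ⟨0, by omega⟩
  set b : Fin d := ⟨1, by omega⟩
  have hab : a ≠ b := by simp [a, b]
  have h := hS (MvPolynomial.X (a, b) ^ 3 - MvPolynomial.X (a, b)) (fun γ hγ => by
    have h1 : |γ.1 a b| ≤ 1 := by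
      exact_mod_cast (abs_entry_le_opNorm γ a b).trans (hcl γ hγ)
    have h2 : γ.1 a b ^ 3 - γ.1 a b = 0 := by
      rw [abs_le] at h1
      obtain ⟨h3, h4⟩ := h1
      interval_cases (γ.1 a b) <;> norm_num
    rw [map_sub, map_pow, MvPolynomial.eval_X]
    exact_mod_cast h2)
    ⟨Matrix.transvection a b 2, Matrix.det_transvection_of_ne a b hab 2⟩
  rw [map_sub, map_pow, MvPolynomial.eval_X] at h
  have h2 : (Matrix.transvection a b (2 : ℝ)) a b = 2 := by
    simp [Matrix.transvection, Matrix.one_apply_ne hab]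
  simp only [h2] at h
  norm_num at h

theorem one_le_spectralModulus (hd : 2 ≤ d) (g : SL(d, ℤ)) : 1 ≤ spectralModulus g := by
  have : Nonempty (Fin d) := ⟨⟨0, by omega⟩⟩
  refine one_le_topModulus _ ?_
  change ‖LinearMap.det (Matrix.toLin' (g.1.map (Int.cast : ℤ → ℂ)))‖ = 1
  rw [LinearMap.det_toLin']
  have := RingHom.map_det (Int.castRingHom ℂ) g.1
  rw [g.2, map_one] at this
  change ‖((Int.castRingHom ℂ).mapMatrix g.1).det‖ = 1
  rw [← this, norm_one]

/-- The spectral gap: `Λ(α)` is bounded away from `1`. -/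
theorem exists_lt_forall_le_spectralModulus (hd : 2 ≤ d) (r : ℝ) : ∃ t : ℝ, 1 < t ∧
    ∀ S : Set SL(d, ℤ), IsZariskiDense (Subgroup.closure S) → ∀ α ∈ S,
      (∀ s ∈ S, opNorm s ≤ spectralModulus α ^ r) → t ≤ spectralModulus α := by
  -- If `Λ(α) < 2`, then `α` lies in a finite set of integer matrices. The extra element 2 covers
  -- the case `Λ(α) ≥ 2` and keeps `F` nonempty.
  set F : Set ℝ := insert 2
    (spectralModulus '' {g : SL(d, ℤ) | opNorm g ≤ 2 ^ |r|} ∩ Set.Ioi 1) with hF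
  have hFfin : F.Finite := (((finite_setOf_opNorm_le _).image _).inter_of_left _).insert 2
  obtain ⟨t, htF, ht⟩ := Set.exists_min_image F id hFfin ⟨2, Set.mem_insert _ _⟩
  have ht1 : 1 < t := by
    rcases htF with rfl | h
    · norm_num
    · exact h.2
  refine ⟨t, ht1, fun S hS α hα hSα => ?_⟩
  have h1 := one_le_spectralModulus hd α
  rcases le_or_gt 2 (spectralModulus α) with h2 | h2
  · exact (ht 2 (Set.mem_insert _ _)).trans h2
  · refine ht _ (Set.mem_insert_of_mem _ ⟨⟨α, ?_, rfl⟩, ?_⟩)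
    · refine (hSα α hα).trans ?_
      refine (Real.rpow_le_rpow_of_exponent_le h1 (le_abs_self r)).trans ?_
      exact Real.rpow_le_rpow (by linarith) h2.le (abs_nonneg r)
    -- `Λ(α) = 1` would bound every norm on `S` by `1 ^ r = 1`.
    · obtain ⟨s, hs, hs1⟩ := exists_one_lt_opNorm hd hS
      refine lt_of_le_of_ne h1 fun he => ?_
      have := hSα s hs
      rw [← he, Real.one_rpow] at this
      linarith

end OpNorm

/-! ### Polynomial bounds on exterior powers -/

section WedgeBounds

variable {d : ℕ}

/-- The determinants for `g` and `g⁻¹` are integers with product 1. -/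
theorem norm_wedgeRep_det (i : ℕ) (g : SL(d, ℤ)) :
    ‖LinearMap.det (wedgeRep d i g).val‖ = 1 := by
  classical
  have hint : ∀ h : SL(d, ℤ), ∃ z : ℤ, LinearMap.det (wedgeRep d i h).val = z := by
    intro h
    refine ⟨(compound i h.1).det, ?_⟩
    rw [← LinearMap.det_toMatrix (EuclideanSpace.basisFun (Set.powersetCard (Fin d) i) ℂ).toBasis]
    have h1 := RingHom.map_det (Int.castRingHom ℂ) (compound i h.1)
    rw [eq_intCast] at h1
    rw [h1, RingHom.mapMatrix_apply, ← compound_map]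
    congr 1
    ext I J
    rw [LinearMap.toMatrix_apply]
    simp [wedgeRep_apply]
  obtain ⟨z, hz⟩ := hint g
  obtain ⟨z', hz'⟩ := hint g⁻¹
  have h1 : LinearMap.det (wedgeRep d i g).val * LinearMap.det (wedgeRep d i g⁻¹).val = 1 := by
    rw [← map_mul, ← Units.val_mul, ← map_mul, mul_inv_cancel, map_one, Units.val_one, map_one]
  rw [hz, hz'] at h1
  have h2 : z * z' = 1 := by exact_mod_cast h1
  rw [hz]
  rcases Int.isUnit_iff.1 (IsUnit.of_mul_eq_one z' h2) with h | h <;> simp [h]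

theorem abs_compound_le (i : ℕ) (hi : i ≤ d) {M : Matrix (Fin d) (Fin d) ℝ} {P : ℝ} (hP : 1 ≤ P)
    (hM : ∀ a b, |M a b| ≤ P) (I J) : |compound i M I J| ≤ d.factorial * P ^ d := by
  rw [compound_apply]
  refine (Matrix.det_le (abv := AbsoluteValue.abs) (x := P) fun a b => hM _ _).trans ?_
  rw [nsmul_eq_mul, Fintype.card_fin]
  have h1 : (i.factorial : ℝ) ≤ d.factorial := by exact_mod_cast Nat.factorial_le hi
  gcongr

theorem abs_inv_entry_le {g : SL(d, ℤ)} {P : ℝ} (hP : 1 ≤ P)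
    (hg : ∀ a b, |((g.1 a b : ℤ) : ℝ)| ≤ P) (a b : Fin d) :
    |(((g⁻¹).1 a b : ℤ) : ℝ)| ≤ d.factorial * P ^ d := by
  rw [Matrix.SpecialLinearGroup.coe_inv]
  have h1 : ((g.1.adjugate a b : ℤ) : ℝ) = (g.1.map (Int.castRingHom ℝ)).adjugate a b := by
    have := RingHom.map_adjugate (Int.castRingHom ℝ) g.1
    rw [RingHom.mapMatrix_apply, RingHom.mapMatrix_apply] at this
    rw [← this]; rfl
  rw [h1, Matrix.adjugate_apply]
  refine (Matrix.det_le (abv := AbsoluteValue.abs) (x := P) fun k l => ?_).trans ?_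
  · rw [Matrix.updateRow_apply]
    split_ifs
    · rw [Pi.single_apply]
      split_ifs
      · simpa using hP
      · simpa using zero_le_one.trans hP
    · exact hg k l
  · rw [nsmul_eq_mul, Fintype.card_fin]

theorem norm_wedgeRep_apply_le (i : ℕ) (g : SL(d, ℤ)) {Q : ℝ} (hQ : 0 ≤ Q)
    (hg : ∀ I J, |compound i (g.1.map (Int.castRingHom ℝ)) I J| ≤ Q) (x : WedgeSpace d i) :
    ‖(wedgeRep d i g).val x‖ ≤ (Fintype.card (Set.powersetCard (Fin d) i)) ^ 2 * Q * ‖x‖ := by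
  set n := Fintype.card (Set.powersetCard (Fin d) i) with hn
  have hcast : ∀ I J, ‖compound i (g.1.map (Int.cast : ℤ → ℂ)) I J‖ ≤ Q := by
    intro I J
    have h1 : g.1.map (Int.cast : ℤ → ℂ)
        = (g.1.map (Int.castRingHom ℝ)).map Complex.ofRealHom := by
      ext a b; simp
    rw [h1, compound_map, Matrix.map_apply, Complex.ofRealHom_eq_coe, Complex.norm_real,
      Real.norm_eq_abs]
    exact hg I J
  have hcoord : ∀ I, ‖(wedgeRep d i g).val x I‖ ≤ n * (Q * ‖x‖) := by
    intro I
    rw [wedgeRep_apply]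
    refine (norm_sum_le _ _).trans ?_
    rw [hn, ← nsmul_eq_mul]
    refine Finset.sum_le_card_nsmul _ _ _ fun J _ => ?_
    rw [norm_mul]
    exact mul_le_mul (hcast I J) (PiLp.norm_apply_le x J) (norm_nonneg _) hQ
  have hsum : ‖(wedgeRep d i g).val x‖ ≤ ∑ I, ‖(wedgeRep d i g).val x I‖ := by
    rw [EuclideanSpace.norm_eq]
    refine Real.sqrt_le_iff.2 ⟨Finset.sum_nonneg fun I _ => norm_nonneg _, ?_⟩
    exact Finset.sum_sq_le_sq_sum_of_nonneg fun I _ => norm_nonneg _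
  refine hsum.trans ((Finset.sum_le_card_nsmul _ _ _ fun I _ => hcoord I).trans (le_of_eq ?_))
  rw [nsmul_eq_mul, Finset.card_univ, ← hn]
  ring

/-- Everything in sight is polynomially bounded in the operator norm. -/
theorem exists_polynomial_bounds (d i : ℕ) (hi : i ≤ d) : ∃ (C : ℝ) (k : ℕ), 1 ≤ C ∧
    ∀ (γ : SL(d, ℤ)) (P : ℝ), 1 ≤ P → opNorm γ ≤ P →
      (∀ j, |minorPairs i (γ.1.map (Int.castRingHom ℝ)) ((γ⁻¹).1.map (Int.castRingHom ℝ)) j|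
        ≤ C * P ^ k) ∧
      (∀ x, ‖(wedgeRep d i γ).val x‖ ≤ C * P ^ k * ‖x‖) ∧
      (∀ x, ‖(wedgeRep d i γ⁻¹).val x‖ ≤ C * P ^ k * ‖x‖) := by
  set n := Fintype.card (Set.powersetCard (Fin d) i) with hn
  set f : ℝ := (d.factorial : ℝ) with hf
  have hf1 : 1 ≤ f := by rw [hf]; exact_mod_cast Nat.one_le_iff_ne_zero.2 d.factorial_ne_zero
  -- Entries of the inverse are at most `P₁ = f P^d`, minors at most `Q = f P₁^d`, and products of
  -- two minors at most `Q²`, whose expansion gives these constants.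
  refine ⟨((n : ℝ) ^ 2 + 1) * (f * f ^ d) ^ 2, d * d * 2, ?_, ?_⟩
  · have h1 : 1 ≤ (f * f ^ d) ^ 2 :=
      one_le_pow₀ (one_le_mul_of_one_le_of_one_le hf1 (one_le_pow₀ hf1))
    have h2 : (1 : ℝ) ≤ (n : ℝ) ^ 2 + 1 := by nlinarith
    exact one_le_mul_of_one_le_of_one_le h2 h1
  intro γ P hP hγ
  have hent : ∀ a b, |((γ.1 a b : ℤ) : ℝ)| ≤ P := fun a b => (abs_entry_le_opNorm γ a b).trans hγ
  set P₁ : ℝ := f * P ^ d with hP₁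
  have hP₁1 : 1 ≤ P₁ := one_le_mul_of_one_le_of_one_le hf1 (one_le_pow₀ hP)
  have hent' := abs_inv_entry_le hP hent
  set Q : ℝ := f * P₁ ^ d with hQ
  have hQ1 : 1 ≤ Q := one_le_mul_of_one_le_of_one_le hf1 (one_le_pow₀ hP₁1)
  have hc' : ∀ I J, |compound i ((γ⁻¹).1.map (Int.castRingHom ℝ)) I J| ≤ Q :=
    abs_compound_le i hi hP₁1 hent'
  have hc : ∀ I J, |compound i (γ.1.map (Int.castRingHom ℝ)) I J| ≤ Q := by
    refine abs_compound_le i hi hP₁1 fun a b => (hent a b).trans ?_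
    by_cases hd0 : d = 0
    · subst hd0; exact a.elim0
    · refine (le_self_pow₀ hP hd0).trans ?_
      exact le_mul_of_one_le_left (by positivity) hf1
  have hQ2 : (f * f ^ d) ^ 2 * P ^ (d * d * 2) = Q ^ 2 := by
    rw [hQ, hP₁, mul_pow f (P ^ d), ← pow_mul, pow_mul P (d * d) 2]
    ring
  have hQQ : Q ≤ Q ^ 2 := le_self_pow₀ hQ1 two_ne_zero
  have hn0 : (0 : ℝ) ≤ (n : ℝ) ^ 2 := by positivity
  rw [mul_assoc, hQ2]
  refine ⟨fun j => ?_, fun x => ?_, fun x => ?_⟩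
  · have h1 : |minorPairs i (γ.1.map (Int.castRingHom ℝ)) ((γ⁻¹).1.map (Int.castRingHom ℝ)) j|
        ≤ Q ^ 2 := by
      rw [minorPairs, abs_mul, sq]
      exact mul_le_mul (hc _ _) (hc' _ _) (abs_nonneg _) (by linarith)
    nlinarith
  · refine (norm_wedgeRep_apply_le i γ (by linarith) hc x).trans ?_
    gcongr
    linarith
  · refine (norm_wedgeRep_apply_le i γ⁻¹ (by linarith) hc' x).trans ?_
    gcongr
    linarith

end WedgeBounds

end VeryContracting

/-! ### Uniform choice of the exponent and conclusion -/

namespace VeryContracting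

open Filter

/-- At `t₀` the exponential beats the polynomial. After cancelling `t ^ k` the left side does not
depend on `t`, while `t ^ (m - k)` increases with `t`, so one threshold for `m` serves all `t ≥ t₀`.
-/
theorem eventually_mul_pow_le_pow {t₀ : ℝ} (ht₀ : 1 < t₀) (n k : ℕ) (C : ℝ) :
    ∀ᶠ m : ℕ in atTop, ∀ t : ℝ, t₀ ≤ t → ((m : ℝ) + 1) ^ n * (C * t ^ k) ≤ t ^ m := by
  have h0 : 0 < t₀ := by linarith
  have hlim := (tendsto_pow_const_div_const_pow_of_one_lt n ht₀).comp (tendsto_add_atTop_nat 1)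
  have hlim2 := hlim.mul_const (C * t₀ ^ (k + 1))
  rw [zero_mul] at hlim2
  filter_upwards [hlim2.eventually_le_const zero_lt_one, eventually_ge_atTop k] with m hm hkm t ht
  have ht0 : 0 < t := h0.trans_le ht
  have h1 : ((m : ℝ) + 1) ^ n * (C * t₀ ^ k) ≤ t₀ ^ m := by
    simp only [Function.comp_apply, Nat.cast_add, Nat.cast_one] at hm
    rw [div_mul_eq_mul_div, div_le_one (by positivity), pow_succ t₀ k, pow_succ t₀ m] at hm
    refine le_of_mul_le_mul_right (le_trans (le_of_eq ?_) hm) h0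
    ring
  obtain ⟨j, rfl⟩ := Nat.exists_eq_add_of_le hkm
  rw [pow_add] at h1 ⊢
  have h2 : (((k + j : ℕ) : ℝ) + 1) ^ n * C ≤ t₀ ^ j := by
    refine le_of_mul_le_mul_right (le_trans (le_of_eq ?_) (h1.trans (le_of_eq (mul_comm _ _))))
      (pow_pos h0 k)
    ring
  calc (((k + j : ℕ) : ℝ) + 1) ^ n * (C * t ^ k)
      = ((((k + j : ℕ) : ℝ) + 1) ^ n * C) * t ^ k := by ring
    _ ≤ t ^ j * t ^ k := by
      gcongr
      exact h2.trans (pow_le_pow_left₀ h0.le ht j)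
    _ = t ^ k * t ^ j := mul_comm _ _

theorem norm_dotProduct_le {ι : Type*} [Fintype ι] (a b : EuclideanSpace ℂ ι) :
    ‖a.ofLp ⬝ᵥ b.ofLp‖ ≤ ‖a‖ * ‖b‖ := by
  have h1 : a.ofLp ⬝ᵥ b.ofLp = inner ℂ (WithLp.toLp 2 (star a.ofLp)) b := by
    rw [EuclideanSpace.inner_eq_star_dotProduct, star_star, dotProduct_comm]
  have h2 : ‖(WithLp.toLp 2 (star a.ofLp) : EuclideanSpace ℂ ι)‖ = ‖a‖ := by
    simp [EuclideanSpace.norm_eq]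
  rw [h1, ← h2]
  exact norm_inner_le_norm _ _

theorem wedgeRep_ofLp {d : ℕ} (i : ℕ) (g : SL(d, ℤ)) (x : WedgeSpace d i) :
    ((wedgeRep d i g).val x).ofLp = (compound i (g.1.map (Int.cast : ℤ → ℂ))).mulVec x.ofLp := by
  ext I
  exact wedgeRep_apply i g x I

/-- `exists_mem_pow_one_le` for a linear form normalised by its value at a unit vector. -/
theorem exists_mem_pow_le_norm_apply {d : ℕ} (hd : 2 ≤ d) (i : ℕ) : ∃ (C : ℝ) (k : ℕ), 0 < C ∧
    ∀ (N : ℕ), Fintype.card (Set.powersetCard (Fin d) i) ^ 4 ≤ N → ∀ S : Set SL(d, ℤ), 1 ∈ S →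
      IsZariskiDense (Subgroup.closure S) → ∀ D : ℝ, 1 ≤ D →
      (∀ γ ∈ S ^ N, (∀ j, |minorPairs i (γ.1.map (Int.castRingHom ℝ))
        ((γ⁻¹).1.map (Int.castRingHom ℝ)) j| ≤ D) ∧
        (∀ x, ‖(wedgeRep d i γ).val x‖ ≤ D * ‖x‖) ∧
        (∀ x, ‖(wedgeRep d i γ⁻¹).val x‖ ≤ D * ‖x‖)) →
      ∀ (f : WedgeSpace d i →ₗ[ℂ] ℂ) (v u : WedgeSpace d i), ‖v‖ = 1 → f v = 1 → ‖u‖ = 1 →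
        ∃ γ ∈ S ^ N, 1 ≤ C * D ^ k * ‖f ((wedgeRep d i γ).val u)‖ ∧
          1 ≤ C * D ^ k * ‖f ((wedgeRep d i γ⁻¹).val u)‖ := by
  classical
  obtain ⟨C, k, hC, h⟩ := exists_mem_pow_one_le hd i
  refine ⟨C, k + 1, hC, fun N hN S h1 hS D hD hSD f v u hv hfv hu => ?_⟩
  set φ : WedgeSpace d i := WithLp.toLp 2 fun I => f (EuclideanSpace.single I 1) with hφ
  have hφf : ∀ x : WedgeSpace d i, f x = φ.ofLp ⬝ᵥ x.ofLp := by
    intro x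
    have hx : x = ∑ I, x I • EuclideanSpace.single I (1 : ℂ) := by
      ext J
      simp [Finset.sum_apply, Pi.single_apply]
    conv_lhs => rw [hx]
    simp [hφ, dotProduct, mul_comm]
  -- Since `f v = 1` at a unit vector, normalising `φ` can only decrease its values, so escape for
  -- `ψ` gives escape for `f`.
  have hφ1 : 1 ≤ ‖φ‖ := by
    have h2 := norm_dotProduct_le φ v
    rwa [← hφf, hfv, hv, mul_one, norm_one] at h2
  have hφ0 : 0 < ‖φ‖ := by linarith
  set ψ : WedgeSpace d i := ((‖φ‖ : ℂ)⁻¹) • φ with hψ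
  have hψ1 : ‖ψ‖ = 1 := by
    rw [hψ, norm_smul, norm_inv, Complex.norm_real, norm_norm, inv_mul_cancel₀ hφ0.ne']
  have hψf : ∀ x : WedgeSpace d i, ‖ψ.ofLp ⬝ᵥ x.ofLp‖ ≤ ‖f x‖ := by
    intro x
    rw [hψ, WithLp.ofLp_smul, smul_dotProduct, ← hφf, norm_smul, norm_inv, Complex.norm_real,
      norm_norm]
    exact mul_le_of_le_one_left (norm_nonneg _) (inv_le_one_of_one_le₀ hφ1)
  obtain ⟨γ, hγ, hle⟩ := h N hN S h1 hS D hD (fun γ hγ => (hSD γ hγ).1) ψ u hψ1 hu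
  obtain ⟨-, hb, hb'⟩ := hSD γ hγ
  rw [← wedgeRep_ofLp, ← wedgeRep_ofLp] at hle
  have hF : ∀ x : WedgeSpace d i, ‖x‖ ≤ D * ‖u‖ → ‖ψ.ofLp ⬝ᵥ x.ofLp‖ ≤ D := by
    intro x hx
    have := norm_dotProduct_le ψ x
    rw [hψ1, one_mul] at this
    rw [hu, mul_one] at hx
    exact this.trans hx
  have h2 := hF _ (hb u)
  have h3 := hF _ (hb' u)
  have h4 := hψf ((wedgeRep d i γ).val u)
  have h5 := hψf ((wedgeRep d i γ⁻¹).val u)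
  have hCD : 0 ≤ C * D ^ k := by positivity
  have hD0 : 0 ≤ D := by linarith
  refine ⟨γ, hγ, hle.trans ?_, hle.trans ?_⟩
  -- Only the product of the two values is known to be large; bounding the other factor by `D` costs
  -- the extra power in `k + 1`.
  · calc _ ≤ C * D ^ k * (‖f ((wedgeRep d i γ).val u)‖ * D) := by gcongr
      _ = _ := by ring
  · calc _ ≤ C * D ^ k * (D * ‖f ((wedgeRep d i γ⁻¹).val u)‖) := by gcongr
      _ = _ := by ring

theorem isTopEigendirection_iff {V : Type*} [NormedAddCommGroup V] [InnerProductSpace ℂ V]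
    [FiniteDimensional ℂ V] {T : Module.End ℂ V} {v : V} (hv : v ≠ 0) {μ : ℂ}
    (hμ : ‖μ‖ = topModulus T) (hTv : T v = μ • v)
    (huniq : ∀ (w : V) (z : ℂ), w ≠ 0 → ‖z‖ = ‖μ‖ → T w = z • w → z = μ ∧ ∃ c : ℂ, w = c • v)
    (w : ℙ ℂ V) : IsTopEigendirection T w ↔ w = Projectivization.mk ℂ v hv := by
  constructor
  · rintro ⟨z, hz, hw⟩
    obtain ⟨-, c, hc⟩ := huniq w.rep z w.rep_nonzero (hz.trans hμ.symm) hw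
    rw [← w.mk_rep, Projectivization.mk_eq_mk_iff']
    exact ⟨c, hc.symm⟩
  · rintro rfl
    obtain ⟨a, ha⟩ := Projectivization.exists_smul_eq_mk_rep ℂ v hv
    refine ⟨μ, hμ, ?_⟩
    rw [← ha, Units.smul_def, map_smul, hTv, smul_comm]

theorem exists_norm_eq_one_forall_norm_apply_le {V : Type*} [NormedAddCommGroup V]
    [InnerProductSpace ℂ V] [FiniteDimensional ℂ V] [Nontrivial V] (U : Module.End ℂ V) :
    ∃ w : V, ‖w‖ = 1 ∧ ∀ p, ‖U p‖ ≤ ‖U w‖ * ‖p‖ := by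
  have hne : (Metric.sphere (0 : V) 1).Nonempty := by
    obtain ⟨x, hx⟩ := exists_ne (0 : V)
    refine ⟨((‖x‖ : ℂ)⁻¹) • x, ?_⟩
    rw [mem_sphere_zero_iff_norm, norm_smul, norm_inv, Complex.norm_real, norm_norm,
      inv_mul_cancel₀ (norm_ne_zero_iff.2 hx)]
  have : ProperSpace V := FiniteDimensional.proper ℂ V
  have hcont : Continuous fun x => ‖U x‖ := U.continuous_of_finiteDimensional.norm
  obtain ⟨w, hw, hmax⟩ := (isCompact_sphere (0 : V) 1).exists_isMaxOn hne hcont.continuousOn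
  refine ⟨w, by simpa using hw, fun p => ?_⟩
  by_cases hp : p = 0
  · simp [hp]
  have hp0 : 0 < ‖p‖ := norm_pos_iff.2 hp
  have h1 : ((‖p‖ : ℂ)⁻¹) • p ∈ Metric.sphere (0 : V) 1 := by
    rw [mem_sphere_zero_iff_norm, norm_smul, norm_inv, Complex.norm_real, norm_norm,
      inv_mul_cancel₀ hp0.ne']
  have h2 : ‖U (((‖p‖ : ℂ)⁻¹) • p)‖ ≤ ‖U w‖ := hmax h1
  rw [map_smul, norm_smul, norm_inv, Complex.norm_real, norm_norm, inv_mul_le_iff₀ hp0] at h2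
  linarith

/-- Powers of a proximal transformation with a definite gap, off its eigenline. -/
theorem exists_proximal_data {V : Type*} [NormedAddCommGroup V] [InnerProductSpace ℂ V]
    [FiniteDimensional ℂ V] [Nontrivial V] (T : Module.End ℂ V) (hdet : ‖LinearMap.det T‖ = 1)
    {D t δ : ℝ} (hD : 1 ≤ D) (hT : ∀ x, ‖T x‖ ≤ D * ‖x‖) (ht : 0 < t) (hδ : 0 < δ)
    (hδt : δ ≤ 1 - t⁻¹) (hgap : t ≤ topModulus T / secondModulus T) :
    ∃ (v : V) (φ : V →ₗ[ℂ] ℂ) (μ : ℂ), ‖v‖ = 1 ∧ φ v = 1 ∧ ‖μ‖ = topModulus T ∧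
      1 ≤ topModulus T ∧ topModulus T ≤ D ∧ T v = μ • v ∧
      (∀ (w : V) (z : ℂ), w ≠ 0 → ‖z‖ = ‖μ‖ → T w = z • w → z = μ ∧ ∃ c : ℂ, w = c • v) ∧
      ∀ (m : ℕ) (x : V), t ^ m * ‖(T ^ m) (x - φ x • v)‖ ≤ topModulus T ^ m *
        (((m : ℝ) + 1) ^ Module.finrank ℂ V * (2 * (3 * (1 + 2 / δ)) ^ Module.finrank ℂ V *
          D ^ (3 * Module.finrank ℂ V))) * ‖x‖ := by
  set Λ := topModulus T with hΛ
  set l := secondModulus T with hl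
  set n := Module.finrank ℂ V with hn
  -- Division by zero gives 0, so a positive gap excludes a vanishing second modulus.
  have hl0 : l ≠ 0 := by
    intro h
    rw [h, div_zero] at hgap
    linarith
  obtain ⟨μ, s, hroots, hμ, hs, hs0⟩ := exists_roots_eq_cons T hl0
  have hlpos : 0 < l := by
    obtain ⟨z, hz⟩ := Multiset.exists_mem_of_ne_zero hs0
    exact lt_of_le_of_ne ((norm_nonneg z).trans (hs z hz)) hl0.symm
  have hΛ1 : 1 ≤ Λ := one_le_topModulus T hdet
  have hΛpos : 0 < Λ := by linarith
  have hΛl : 1 ≤ Λ * l := one_le_topModulus_mul_secondModulus T hdet hlpos hΛ1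
  have hΛD : Λ ≤ D := by
    obtain ⟨z, w, hw, hTw, hz⟩ := exists_root_norm_eq_topModulus T
    have h1 := hT w
    rw [hTw, norm_smul, hz] at h1
    exact le_of_mul_le_mul_right h1 (norm_pos_iff.2 hw)
  have htl : t * l ≤ Λ := (le_div_iff₀ hlpos).1 hgap
  have hlt : l ≤ Λ * t⁻¹ := by
    rw [← div_eq_mul_inv, le_div_iff₀ ht, mul_comm]; exact htl
  have hgapδ : δ ≤ Λ - l := by nlinarith
  have hlΛ : l < ‖μ‖ := by rw [hμ]; linarith
  have hK : ∀ z : ℂ, ‖z‖ ≤ l → ∀ x, ‖T x - z • x‖ ≤ 2 * D * ‖x‖ := by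
    intro z hz x
    have h1 := norm_sub_le (T x) (z • x)
    rw [norm_smul] at h1
    have h2 : ‖z‖ * ‖x‖ ≤ D * ‖x‖ := by gcongr; linarith
    linarith [hT x]
  have hD0 : 0 ≤ D := by linarith
  obtain ⟨v, φ, hv, hφv, hTv, hker, hφ, huniq⟩ :=
    exists_eigenvector_functional T hroots hs hlΛ (by linarith : 0 ≤ 2 * D) hK
  refine ⟨v, φ, μ, hv, hφv, hμ, hΛ1, hΛD, hTv, huniq, fun m x => ?_⟩
  have hcard : s.card ≤ n := by
    have h1 : T.charpoly.roots.card = n := by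
      rw [← (IsAlgClosed.splits T.charpoly).natDegree_eq_card_roots, LinearMap.charpoly_natDegree]
    rw [hroots, Multiset.card_cons] at h1
    omega
  have hpow := norm_pow_apply_le T hlpos (by linarith : 0 ≤ 2 * D) hK s hs _ (hker x) m
  set c := 1 + 2 / δ with hc
  have h2δ : 0 < 2 / δ := by positivity
  have hc1 : 1 ≤ c := by linarith
  have hcD : 1 ≤ c * D := one_le_mul_of_one_le_of_one_le hc1 hD
  have hDD : 1 ≤ D ^ 2 := one_le_pow₀ hD
  have hφx : ‖φ x‖ ≤ (c * D) ^ n * ‖x‖ := by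
    refine (hφ x).trans ?_
    gcongr
    have h1 : 2 * D / (‖μ‖ - l) ≤ c * D := by
      rw [div_le_iff₀ (by linarith), hμ]
      have h2 : c * δ = δ + 2 := by rw [hc, add_mul, div_mul_cancel₀ _ hδ.ne', one_mul]
      have h3 : c * δ ≤ c * (Λ - l) := by gcongr
      nlinarith
    have h0 : 0 ≤ 2 * D / (‖μ‖ - l) := div_nonneg (by linarith) (by linarith)
    exact (pow_le_pow_left₀ h0 h1 _).trans (pow_le_pow_right₀ hcD hcard)
  have hx : ‖x - φ x • v‖ ≤ 2 * (c * D) ^ n * ‖x‖ := by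
    have h1 := norm_sub_le x (φ x • v)
    rw [norm_smul, hv, mul_one] at h1
    have h2 : 1 ≤ (c * D) ^ n := one_le_pow₀ hcD
    nlinarith [norm_nonneg x]
  -- The unit determinant gives `l ≥ 1 / Λ ≥ 1 / D`, which keeps division by `l` polynomial in `D`.
  have hKl : (1 + 2 * D / l) ≤ 3 * D ^ 2 := by
    have h1 : 2 * D / l ≤ 2 * D ^ 2 := by
      rw [div_le_iff₀ hlpos]
      have : 1 ≤ D * l := hΛl.trans (by gcongr)
      nlinarith
    linarith
  have hKl1 : 1 ≤ 1 + 2 * D / l := by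
    have : 0 ≤ 2 * D / l := div_nonneg (by linarith) hlpos.le
    linarith
  have hm1 : (1 : ℝ) ≤ m + 1 := by
    have : (0 : ℝ) ≤ m := Nat.cast_nonneg m
    linarith
  have h1 : ‖(T ^ m) (x - φ x • v)‖ ≤ l ^ m * (((m : ℝ) + 1) ^ n * (3 * D ^ 2) ^ n) *
      (2 * (c * D) ^ n * ‖x‖) := by
    refine hpow.trans ?_
    have h3 : (1 + 2 * D / l) ^ s.card ≤ (3 * D ^ 2) ^ n :=
      (pow_le_pow_right₀ hKl1 hcard).trans (pow_le_pow_left₀ (by linarith) hKl n)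
    have h4 : ((m : ℝ) + 1) ^ s.card ≤ (m + 1) ^ n := pow_le_pow_right₀ hm1 hcard
    have h5 : 0 ≤ (1 + 2 * D / l) ^ s.card := pow_nonneg (by linarith) _
    gcongr
  calc t ^ m * ‖(T ^ m) (x - φ x • v)‖
      ≤ t ^ m * (l ^ m * (((m : ℝ) + 1) ^ n * (3 * D ^ 2) ^ n) * (2 * (c * D) ^ n * ‖x‖)) := by
        gcongr
    _ = (t * l) ^ m * (((m : ℝ) + 1) ^ n * (2 * (3 * c) ^ n * D ^ (3 * n))) * ‖x‖ := by
        rw [mul_pow t, mul_pow 3 c, mul_pow 3 (D ^ 2), mul_pow c D, ← pow_mul D 2 n,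
          show 3 * n = 2 * n + n by ring, pow_add D]
        ring
    _ ≤ _ := by gcongr

/-- The main statement for one exterior power, for all large exponents. -/
theorem eventually_exists_veryContracting {d : ℕ} (hd : 2 ≤ d) {i : ℕ} (hi : i ≤ d) {N : ℕ}
    (hN : Fintype.card (Set.powersetCard (Fin d) i) ^ 4 ≤ N) (r : ℝ) (q : ℕ) :
    ∀ᶠ m : ℕ in atTop,
      ∀ S : Set SL(d, ℤ), 1 ∈ S → IsZariskiDense (Subgroup.closure S) →
      ∀ α ∈ S, (∀ s ∈ S, opNorm s ≤ spectralModulus α ^ r) →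
      ∀ A : LinearMap.GeneralLinearGroup ℂ (WedgeSpace d i),
      A = wedgeRep d i α →
      spectralModulus α ^ (1 / d : ℝ) ≤
        topModulus A.val / secondModulus A.val →
      ∃ v : ℙ ℂ (WedgeSpace d i),
        (∀ w, IsTopEigendirection A.val w ↔ w = v) ∧
        ∃ B ∈ (wedgeRep d i '' S) ^ N,
          IsVeryContractingWith (topModulus A.val ^ (-(q : ℝ)))
            (A ^ m * B * (A ^ m)⁻¹) v v ∧ 1 ≤ topModulus A.val := by
  obtain ⟨C₁, k₁, hC₁, hbound⟩ := exists_polynomial_bounds d i hi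
  obtain ⟨C₂, k₂, hC₂, hescape⟩ := exists_mem_pow_le_norm_apply hd i
  obtain ⟨T₀, hT₀, hgap⟩ := exists_lt_forall_le_spectralModulus hd r
  have hd0 : (0 : ℝ) < 1 / d := by
    have : (0 : ℝ) < d := by exact_mod_cast (by omega : 0 < d)
    positivity
  set t₀ : ℝ := T₀ ^ (1 / d : ℝ) with ht₀
  have ht₀1 : 1 < t₀ := Real.one_lt_rpow hT₀ hd0
  set δ : ℝ := 1 - t₀⁻¹ with hδ
  have hδ0 : 0 < δ := by
    have := inv_lt_one_of_one_lt₀ ht₀1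
    linarith
  set n := Module.finrank ℂ (WedgeSpace d i)
  set R : ℕ := ⌈|r|⌉₊
  -- This is the exponent in `D = C₁ * t ^ e₁`, as `T = t ^ d` and `P = T ^ (R * (N + 1))`. The
  -- exponent `e₂` counts powers of `D`: `3n` from the growth off the eigenline, 1 from the norm of
  -- `B`, `2q` from `ε⁻²`, and `k₂` from the escape estimate.
  set e₁ : ℕ := d * (R * (N + 1) * k₁) with he₁
  set e₂ : ℕ := 3 * n + 1 + 2 * q + k₂ with he₂
  set C₃ : ℝ := 2 * (2 * (3 * (1 + 2 / δ)) ^ n) * C₂ * C₁ ^ e₂ with hC₃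
  have hnonempty : Nonempty (Set.powersetCard (Fin d) i) := by
    obtain ⟨s, -, hs⟩ := Finset.exists_subset_card_eq (s := (Finset.univ : Finset (Fin d)))
      (n := i) (by simpa using hi)
    exact ⟨⟨s, hs⟩⟩
  filter_upwards [eventually_mul_pow_le_pow ht₀1 n (e₁ * e₂) C₃] with m hm
  intro S h1 hS α hα hnorm A hA hratio
  set T := spectralModulus α with hT
  have hT₀T : T₀ ≤ T := hgap S hS α hα hnorm
  have hT1 : 1 ≤ T := by linarith
  set t : ℝ := T ^ (1 / d : ℝ) with ht
  have ht₀t : t₀ ≤ t := Real.rpow_le_rpow (by linarith) hT₀T hd0.le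
  have htpos : 0 < t := by linarith
  have hTt : T = t ^ d := by
    rw [ht, ← Real.rpow_natCast, ← Real.rpow_mul (by linarith), one_div,
      inv_mul_cancel₀ (by exact_mod_cast (by omega : d ≠ 0)), Real.rpow_one]
  have hSR : ∀ s ∈ S, opNorm s ≤ T ^ R := by
    intro s hs
    refine (hnorm s hs).trans ?_
    rw [← Real.rpow_natCast]
    exact Real.rpow_le_rpow_of_exponent_le hT1 ((le_abs_self r).trans (Nat.le_ceil _))
  set P : ℝ := (T ^ R) ^ (N + 1) with hP
  have hTR : 1 ≤ T ^ R := one_le_pow₀ hT1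
  have hP1 : 1 ≤ P := one_le_pow₀ hTR
  set D : ℝ := C₁ * P ^ k₁ with hD
  have hD1 : 1 ≤ D := one_le_mul_of_one_le_of_one_le hC₁ (one_le_pow₀ hP1)
  have hDt : D = C₁ * t ^ e₁ := by
    rw [hD, hP, hTt, he₁]
    simp only [← pow_mul, mul_assoc]
  have hSN : ∀ γ ∈ S ^ N, opNorm γ ≤ P := fun γ hγ =>
    (opNorm_le_pow_of_mem_pow (by linarith) hSR N γ hγ).trans
      (pow_le_pow_right₀ hTR (Nat.le_succ N))
  have hAD : ∀ x, ‖A.val x‖ ≤ D * ‖x‖ := by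
    rw [hA]
    exact (hbound α P hP1 ((hSR α hα).trans (le_self_pow₀ hTR (Nat.succ_ne_zero N)))).2.1
  have hdet : ‖LinearMap.det A.val‖ = 1 := by rw [hA]; exact norm_wedgeRep_det i α
  have hδt : δ ≤ 1 - t⁻¹ := by
    have := inv_anti₀ (by linarith) ht₀t
    linarith
  obtain ⟨v, φ, μ, hv, hφv, hμ, hΛ1, hΛD, hAv, huniq, hgrow⟩ :=
    exists_proximal_data A.val hdet hD1 hAD htpos hδ0 hδt hratio
  have hv0 : v ≠ 0 := by rw [← norm_ne_zero_iff, hv]; exact one_ne_zero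
  refine ⟨Projectivization.mk ℂ v hv0, isTopEigendirection_iff hv0 hμ hAv huniq, ?_⟩
  -- The direction `u` of `A^{-m} w` depends on `m`, but the escape estimate is uniform in `u`, so
  -- the word may be chosen after `m`.
  obtain ⟨w, hw, hwmax⟩ := exists_norm_eq_one_forall_norm_apply_le ((A ^ m)⁻¹).val
  set x := ((A ^ m)⁻¹).val w with hx
  have hx0 : x ≠ 0 := by
    intro h
    have hw0 : w = 0 := by
      have h2 : ((A ^ m) * (A ^ m)⁻¹).val w = w := by rw [mul_inv_cancel]; rfl
      rw [← h2, Units.val_mul, Module.End.mul_apply, ← hx, h, map_zero]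
    rw [hw0, norm_zero] at hw
    exact zero_ne_one hw
  have hxn : 0 < ‖x‖ := norm_pos_iff.2 hx0
  set u : WedgeSpace d i := ((‖x‖ : ℂ)⁻¹) • x with hu
  have hu1 : ‖u‖ = 1 := by
    rw [hu, norm_smul, norm_inv, Complex.norm_real, norm_norm, inv_mul_cancel₀ hxn.ne']
  have hxu : x = (‖x‖ : ℂ) • u := by
    rw [hu, smul_smul, mul_inv_cancel₀ (by exact_mod_cast hxn.ne'), one_smul]
  obtain ⟨γ, hγ, hγ1, hγ2⟩ := hescape N hN S h1 hS D hD1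
    (fun γ hγ => hbound γ P hP1 (hSN γ hγ)) φ v u hv hφv hu1
  obtain ⟨-, hB, hB'⟩ := hbound γ P hP1 (hSN γ hγ)
  set Λ := topModulus A.val with hΛ
  have hΛ0 : 0 < Λ := by linarith
  have hD0 : 0 < D := by linarith
  set ε : ℝ := Λ ^ (-(q : ℝ)) with hε
  have hεq : ε = (Λ ^ q)⁻¹ := by rw [hε, Real.rpow_neg hΛ0.le, Real.rpow_natCast]
  have hε0 : 0 < ε := Real.rpow_pos_of_pos hΛ0 _
  have hε1 : ε ≤ 1 := by rw [hεq]; exact inv_le_one_of_one_le₀ (one_le_pow₀ hΛ1)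
  set η : ℝ := (C₂ * D ^ k₂)⁻¹ with hη
  have hη0 : 0 < η := by positivity
  have hηle : ∀ b : SL(d, ℤ), 1 ≤ C₂ * D ^ k₂ * ‖φ ((wedgeRep d i b).val u)‖ →
      η * ‖x‖ ≤ ‖φ ((wedgeRep d i b).val x)‖ := by
    intro b hb
    have h2 : η ≤ ‖φ ((wedgeRep d i b).val u)‖ := by
      rw [hη, inv_le_iff_one_le_mul₀' (by positivity)]
      exact hb
    conv_rhs => rw [hxu, map_smul, map_smul, norm_smul, Complex.norm_real, norm_norm]
    rw [mul_comm]
    gcongr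
  set G : ℝ := ((m : ℝ) + 1) ^ n * (2 * (3 * (1 + 2 / δ)) ^ n * D ^ (3 * n)) with hG
  have hG0 : 0 ≤ G := by positivity
  set κ : ℝ := Λ ^ m * G / t ^ m with hκ
  have hκ0 : 0 ≤ κ := by positivity
  have hgrow' : ∀ y, ‖(A.val ^ m) (y - φ y • v)‖ ≤ κ * ‖y‖ := by
    intro y
    rw [hκ, div_mul_eq_mul_div, le_div_iff₀ (by positivity), mul_comm]
    exact hgrow m y
  have hbig : 2 * κ * D ≤ ε ^ 2 * (‖μ‖ ^ m * η) := by
    have h2 := hm t ht₀t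
    have h3 : C₃ * t ^ (e₁ * e₂)
        = 2 * (2 * (3 * (1 + 2 / δ)) ^ n) * C₂ * D ^ e₂ := by
      rw [hC₃, hDt, mul_pow C₁, ← pow_mul t]
      ring
    rw [h3, he₂, pow_add, pow_add, pow_add, pow_one] at h2
    have h4 : (Λ ^ q) ^ 2 ≤ D ^ (2 * q) := by
      rw [← pow_mul, mul_comm q 2]
      exact pow_le_pow_left₀ hΛ0.le hΛD _
    have h5 : 2 * G * D * (Λ ^ q) ^ 2 * (C₂ * D ^ k₂) ≤ t ^ m := by
      calc _ ≤ 2 * G * D * D ^ (2 * q) * (C₂ * D ^ k₂) := by gcongr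
        _ = ((m : ℝ) + 1) ^ n * (2 * (2 * (3 * (1 + 2 / δ)) ^ n) * C₂ *
            (D ^ (3 * n) * D * D ^ (2 * q) * D ^ k₂)) := by rw [hG]; ring
        _ ≤ _ := h2
    have h6 : 0 < (Λ ^ q) ^ 2 * (C₂ * D ^ k₂) := by positivity
    rw [hκ, hμ, hεq, hη, inv_pow]
    rw [show ((Λ ^ q) ^ 2)⁻¹ * (Λ ^ m * (C₂ * D ^ k₂)⁻¹)
      = Λ ^ m / ((Λ ^ q) ^ 2 * (C₂ * D ^ k₂)) by field_simp]
    rw [show 2 * (Λ ^ m * G / t ^ m) * D = Λ ^ m * (2 * G * D) / t ^ m by ring]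
    rw [div_le_div_iff₀ (by positivity) h6, mul_assoc]
    gcongr
    linarith
  have hinv : (wedgeRep d i γ)⁻¹ = wedgeRep d i γ⁻¹ := (map_inv _ _).symm
  refine ⟨wedgeRep d i γ, ?_, ⟨?_, ?_⟩, hΛ1⟩
  · rw [← Set.image_pow]
    exact ⟨γ, hγ, rfl⟩
  · exact isContractingWith_conj_pow A (wedgeRep d i γ) m hv hv0 hAv hκ0 hgrow' hD0.le hB hw hwmax
      hη0 (hηle γ hγ1) hε0 hε1 hbig
  · rw [show (A ^ m * wedgeRep d i γ * (A ^ m)⁻¹)⁻¹ = A ^ m * wedgeRep d i γ⁻¹ * (A ^ m)⁻¹ by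
      rw [← hinv]; group]
    exact isContractingWith_conj_pow A (wedgeRep d i γ⁻¹) m hv hv0 hAv hκ0 hgrow' hD0.le hB' hw
      hwmax hη0 (hηle γ⁻¹ hγ2) hε0 hε1 hbig

end VeryContracting

theorem mainTheorem11 (d : ℕ) :
    ∃ N : ℕ, ∀ (r : ℝ) (q : ℕ), ∃ m₀ : ℕ, 0 < m₀ ∧
      ∀ S : Set SL(d, ℤ), 1 ∈ S → IsZariskiDense (Subgroup.closure S) →
      ∀ α ∈ S, (∀ s ∈ S, spectralModulus s ≤ spectralModulus α) →
      (∀ s ∈ S, opNorm s ≤ spectralModulus α ^ r) →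
      ∀ i : ℕ, 1 ≤ i → i < d →
      ∀ A : LinearMap.GeneralLinearGroup ℂ (WedgeSpace d i),
      A = wedgeRep d i α →
      spectralModulus α ^ (1 / d : ℝ) ≤
        topModulus A.val / secondModulus A.val →
      ∃ v : ℙ ℂ (WedgeSpace d i),
        (∀ w, IsTopEigendirection A.val w ↔ w = v) ∧
        ∃ B ∈ (wedgeRep d i '' S) ^ N,
        ∃ v₁ v₂ : ℙ ℂ (WedgeSpace d i),
          IsVeryContractingWith (topModulus A.val ^ (-(q : ℝ)))
            (A ^ m₀ * B * (A ^ m₀)⁻¹) v₁ v₂ ∧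
          projDist v₁ v ≤ topModulus A.val ^ (-(q : ℝ)) ∧
          projDist v₂ v ≤ topModulus A.val ^ (-(q : ℝ)) := by
  -- The pairs of `i`-minors live in dimension `binom(d, i)^4`; the sum over `i` gives a length that
  -- serves every exterior power.
  obtain ⟨N, hN⟩ : ∃ N : ℕ, ∀ i < d, Fintype.card (Set.powersetCard (Fin d) i) ^ 4 ≤ N :=
    ⟨∑ i ∈ Finset.range d, Fintype.card (Set.powersetCard (Fin d) i) ^ 4, fun i hi =>
      Finset.single_le_sum (f := fun i => Fintype.card (Set.powersetCard (Fin d) i) ^ 4)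
        (fun _ _ => Nat.zero_le _) (Finset.mem_range.2 hi)⟩
  refine ⟨N, fun r q => ?_⟩
  -- Only finitely many `i` occur, so one exponent is large enough for all of them.
  have hev := (Filter.eventually_all_finite (Set.finite_Ico 1 d)).2 fun i hi =>
    eventually_exists_veryContracting (by have := hi.1; have := hi.2; omega) hi.2.le
      (hN i hi.2) r q
  obtain ⟨m, hm, hm0⟩ := (hev.and (Filter.eventually_gt_atTop 0)).exists
  refine ⟨m, hm0, fun S h1 hS α hα _ hnorm i hi hid A hA hratio => ?_⟩
  obtain ⟨v, hv, B, hB, hcontr, hΛ⟩ := hm i ⟨hi, hid⟩ S h1 hS α hα hnorm A hA hratio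
  have hdist : projDist v v ≤ topModulus A.val ^ (-(q : ℝ)) := by
    rw [projDist_self]
    exact Real.rpow_nonneg (by linarith) _
  exact ⟨v, hv, B, hB, v, v, hcontr, hdist, hdist⟩
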